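/- Let $p$ be a prime, let $K$ be a field of characteristic $p$, and let $\delta$ be a derivation of $K$ with field of constants $F=\{a\in K : \delta(a)=0\}$. Assume that $\delta$ is algebraic, i.e. algebraic over $F$ as an element of $\mathrm{End}_F(K)$, and let $g\in F[t]$ be its minimum polynomial over $F$, of degree $p^e$. Let $R=K[t;\delta]$ be the differential polynomial ring, i.e. the ring of skew polynomials $\sum a_i t^i$ with coefficients $a_i\in K$ on the left, added termwise and multiplied by means of $ta=at+\delta(a)$ for $a\in K$. Put $x=g(t)\in R$; then $x$ is central in $R$, and the center of $R$ is the polynomial ring $F[x]$. Let $K(t;\delta)=\{f/c : f\in R,\ 0\neq c\in F[x]\}$ be the ring of central quotients of $R$, which is a central simple algebra of degree $p^e$ over the quotient field $F(x)$ of $F[x]$, and let $N:K(t;\delta)\to F(x)$ be its reduced norm. (i) For every $f\in R$ we have $N(f)\in F[x]$, and $f$ divides $N(f)$ in $R$ on both sides: there is $h\in R$ such that $N(f)=fh=hf$. (ii) If $f=a_0+a_1t+\dots+a_mt^m\in R$ has degree $m$ (so $a_m\neq 0$), then $a_m^{p^e}\in F$ and $$N(f)=(-1)^{m(p^e-1)}a_m^{p^e}x^m+Q(x)$$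 for some polynomial $Q\in F[x]$ of degree less than $m$ in $x$. -/

import Mathlib

open Polynomial TensorProduct

/-! ### Derivations of a field: constants and minimum polynomial -/

section Constants

variable {K : Type*} [Field K]

/-- The field of constants `Const(δ) = {a ∈ K | δ a = 0}`. -/
def constField (δ : Derivation ℤ K K) : Subfield K where
  carrier := {a | δ a = 0}
  mul_mem' {a b} ha hb := by
    simp only [Set.mem_ofPred_eq] at *
    simp [Derivation.leibniz, ha, hb]
  one_mem' := δ.map_one_eq_zero
  add_mem' {a b} ha hb := by
    simp only [Set.mem_ofPred_eq] at *
    simp [ha, hb]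
  zero_mem' := map_zero δ
  neg_mem' {a} ha := by
    simp only [Set.mem_ofPred_eq] at *
    simp [ha]
  inv_mem' a ha := by
    simp only [Set.mem_ofPred_eq] at *
    simp [Derivation.leibniz_inv, ha]

theorem mem_constField {δ : Derivation ℤ K K} {a : K} : a ∈ constField δ ↔ δ a = 0 := Iff.rfl

/-- `δ` as an endomorphism of the vector space `K` over `F = Const(δ)`. -/
def derivEnd (δ : Derivation ℤ K K) : Module.End (constField δ) K where
  toFun := δ
  map_add' := map_add δ
  map_smul' c a := by
    have hc : δ (c : K) = 0 := c.2
    simp [Subfield.smul_def, Derivation.leibniz, hc]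

/-- The minimum polynomial of `δ` over `F = Const(δ)`. -/
noncomputable def derivMinpoly (δ : Derivation ℤ K K) : (constField δ)[X] :=
  minpoly (constField δ) (derivEnd δ)

end Constants

/-! ### The differential polynomial ring `K[t; δ]` -/

/-- The differential polynomial ring `K[t; δ]`. Its underlying additive group is that of `K[X]`,
the polynomial `∑ aᵢ Xⁱ` standing for the skew polynomial `∑ aᵢ tⁱ`. -/
def DiffPoly {K : Type*} [Field K] (_δ : Derivation ℤ K K) : Type _ := K[X]

namespace DiffPoly

variable {K : Type*} [Field K] (δ : Derivation ℤ K K)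

noncomputable instance : AddCommGroup (DiffPoly δ) := inferInstanceAs (AddCommGroup K[X])

instance : Nontrivial (DiffPoly δ) := inferInstanceAs (Nontrivial K[X])

/-- The skew polynomial `∑ aᵢ tⁱ` with the coefficients of a given polynomial `∑ aᵢ Xⁱ`. -/
noncomputable def ofPoly : K[X] ≃+ DiffPoly δ := AddEquiv.refl _

variable {δ} in
/-- The polynomial `∑ aᵢ Xⁱ` with the coefficients of a given skew polynomial `∑ aᵢ tⁱ`. -/
noncomputable def toPoly : DiffPoly δ ≃+ K[X] := (ofPoly δ).symm

/-- Left multiplication by `t` on skew polynomials (with coefficients on the left):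
`t · ∑ aᵢ tⁱ = ∑ aᵢ tⁱ⁺¹ + ∑ δ(aᵢ) tⁱ`. -/
noncomputable def tMul : Module.End ℤ K[X] where
  toFun f := X * f + f.sum fun i a => monomial i (δ a)
  map_add' f g := by
    rw [Polynomial.sum_add_index f g _ (by simp) (by simp)]
    ring
  map_smul' n f := by
    have h : ((n • f).sum fun i a => monomial i (δ a)) =
        n • f.sum fun i a => monomial i (δ a) := by
      rw [Polynomial.sum_smul_index' _ _ _ (by simp)]
      simp only [Polynomial.sum, Finset.smul_sum, map_zsmul]
    rw [h, mul_smul_comm, ← smul_add]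
    rfl

/-- Left multiplication by a skew polynomial `∑ aᵢ tⁱ`: the operator
`g ↦ ∑ aᵢ · tⁱ g`, obtained by substituting the operator `tMul δ` for the variable. -/
noncomputable def leftMul (f : K[X]) : Module.End ℤ K[X] :=
  f.eval₂ (Module.toModuleEnd ℤ K[X]) (tMul δ)

theorem tMul_monomial (i : ℕ) (a : K) :
    tMul δ (monomial i a) = monomial (i + 1) a + monomial i (δ a) := by
  change X * monomial i a + (monomial i a).sum (fun i a => monomial i (δ a)) = _
  rw [X_mul_monomial, sum_monomial_index _ _ (by simp)]

theorem leftMul_add (f g : K[X]) : leftMul δ (f + g) = leftMul δ f + leftMul δ g :=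
  eval₂_add _ _

theorem leftMul_monomial (i : ℕ) (a : K) :
    leftMul δ (monomial i a) = Module.toModuleEnd ℤ K[X] a * tMul δ ^ i :=
  eval₂_monomial _ _

theorem leftMul_smul (a : K) (f : K[X]) :
    leftMul δ (a • f) = Module.toModuleEnd ℤ K[X] a * leftMul δ f := by
  induction f using Polynomial.induction_on' with
  | add p q hp hq => rw [smul_add, leftMul_add, hp, hq, leftMul_add, mul_add]
  | monomial i b =>
    rw [smul_monomial, leftMul_monomial, leftMul_monomial, smul_eq_mul, map_mul, mul_assoc]

theorem tMul_smul (a : K) (f : K[X]) : tMul δ (a • f) = a • tMul δ f + δ a • f := by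
  induction f using Polynomial.induction_on' with
  | add p q hp hq => simp only [smul_add, map_add, hp, hq]; abel
  | monomial i b =>
    simp only [smul_monomial, tMul_monomial, smul_add, smul_eq_mul, Derivation.leibniz,
      map_add, add_assoc]
    rw [mul_comm b]

theorem leftMul_tMul (f : K[X]) : leftMul δ (tMul δ f) = tMul δ * leftMul δ f := by
  induction f using Polynomial.induction_on' with
  | add p q hp hq => rw [map_add, leftMul_add, hp, hq, leftMul_add, mul_add]
  | monomial i b =>
    rw [tMul_monomial, leftMul_add, leftMul_monomial, leftMul_monomial, leftMul_monomial,
      pow_succ', ← mul_assoc, ← mul_assoc, ← add_mul]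
    congr 1
    ext1 g
    exact (tMul_smul δ b g).symm

theorem leftMul_leftMul (f g : K[X]) :
    leftMul δ (leftMul δ f g) = leftMul δ f * leftMul δ g := by
  induction f using Polynomial.induction_on' with
  | add p q hp hq =>
    rw [leftMul_add, LinearMap.add_apply, leftMul_add, hp, hq, add_mul]
  | monomial i b =>
    have key : ∀ i : ℕ, leftMul δ ((tMul δ ^ i) g) = tMul δ ^ i * leftMul δ g := by
      intro i
      induction i with
      | zero => simp
      | succ i ih =>
        rw [pow_succ', mul_assoc, ← ih, ← leftMul_tMul]
        rfl
    rw [leftMul_monomial, mul_assoc, ← key, ← leftMul_smul]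
    rfl

theorem leftMul_one : leftMul δ 1 = 1 := eval₂_one _ _

theorem tMul_pow_one (i : ℕ) : (tMul δ ^ i) 1 = X ^ i := by
  induction i with
  | zero => simp
  | succ i ih =>
    rw [pow_succ', Module.End.mul_apply, ih, ← monomial_one_right_eq_X_pow, tMul_monomial,
      monomial_one_right_eq_X_pow]
    simp

theorem leftMul_apply_one (f : K[X]) : leftMul δ f 1 = f := by
  induction f using Polynomial.induction_on' with
  | add p q hp hq =>
    rw [leftMul_add, LinearMap.add_apply, hp, hq]
  | monomial i b =>
    rw [leftMul_monomial, Module.End.mul_apply, tMul_pow_one]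
    exact smul_X_eq_monomial

/-- The multiplication of `K[t; δ]` is the one determined by `t a = a t + δ(a)` for `a ∈ K`. -/
noncomputable instance : Ring (DiffPoly δ) where
  __ := (inferInstance : AddCommGroup (DiffPoly δ))
  mul f g := ofPoly δ (leftMul δ (toPoly f) (toPoly g))
  one := ofPoly δ 1
  mul_assoc f g h := by
    change leftMul δ (leftMul δ (toPoly f) (toPoly g)) (toPoly h) = _
    rw [leftMul_leftMul]
    rfl
  one_mul f := by
    change leftMul δ 1 (toPoly f) = _
    rw [leftMul_one]
    rfl
  mul_one f := leftMul_apply_one δ (toPoly f)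
  left_distrib f g h := map_add (leftMul δ (toPoly f)) (toPoly g) (toPoly h)
  right_distrib f g h := by
    change leftMul δ (toPoly f + toPoly g) (toPoly h) = _
    rw [leftMul_add]
    rfl
  zero_mul f := by
    change leftMul δ 0 (toPoly f) = 0
    simp [leftMul]
  mul_zero f := map_zero (leftMul δ (toPoly f))

theorem toPoly_mul (f g : DiffPoly δ) : toPoly (f * g) = leftMul δ (toPoly f) (toPoly g) := rfl

theorem toPoly_one : toPoly (1 : DiffPoly δ) = 1 := rfl

/-- The inclusion `K → K[t; δ]` of the constant skew polynomials. -/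
noncomputable def C : K →+* DiffPoly δ where
  toFun a := ofPoly δ (Polynomial.C a)
  map_one' := rfl
  map_zero' := map_zero Polynomial.C
  map_add' a b := map_add Polynomial.C a b
  map_mul' a b := by
    apply (toPoly (δ := δ)).injective
    rw [toPoly_mul]
    change Polynomial.C (a * b) = leftMul δ (Polynomial.C a) (Polynomial.C b)
    rw [leftMul, eval₂_C, map_mul, ← smul_eq_C_mul]
    rfl

theorem toPoly_C (a : K) : toPoly (C δ a) = Polynomial.C a := rfl

theorem toPoly_C_mul (a : K) (f : DiffPoly δ) : toPoly (C δ a * f) = a • toPoly f := by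
  rw [toPoly_mul, toPoly_C, ← monomial_zero_left, leftMul_monomial]
  rfl

/-- The variable `t`. -/
noncomputable def t : DiffPoly δ := ofPoly δ X

theorem toPoly_t_mul (f : DiffPoly δ) : toPoly (t δ * f) = tMul δ (toPoly f) := by
  rw [toPoly_mul]
  change leftMul δ X _ = _
  rw [leftMul, eval₂_X]

/-- The defining relation of `K[t; δ]`. -/
theorem t_mul_C (a : K) : t δ * C δ a = C δ a * t δ + C δ (δ a) := by
  apply (toPoly (δ := δ)).injective
  rw [map_add, toPoly_t_mul, toPoly_C_mul, toPoly_C, toPoly_C]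
  change _ = a • X + _
  rw [← monomial_zero_left, tMul_monomial, monomial_zero_left, ← C_mul_X_eq_monomial,
    smul_eq_C_mul]

theorem toPoly_C_mul_t_pow (a : K) (i : ℕ) : toPoly (C δ a * t δ ^ i) = monomial i a := by
  have h : toPoly (t δ ^ i) = X ^ i := by
    rw [← tMul_pow_one δ i]
    induction i with
    | zero => rfl
    | succ i ih => rw [pow_succ', toPoly_t_mul, ih, pow_succ', Module.End.mul_apply]
  rw [toPoly_C_mul, h, smul_X_eq_monomial]

/-- Every skew polynomial is `∑ aᵢ tⁱ` with `aᵢ ∈ K` its `i`-th coefficient. -/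
theorem eq_sum (f : DiffPoly δ) : f = (toPoly f).sum fun i a => C δ a * t δ ^ i := by
  apply (toPoly (δ := δ)).injective
  rw [Polynomial.sum, map_sum]
  simp only [toPoly_C_mul_t_pow]
  exact (toPoly f).as_sum_support

/-- `K[t; δ]` is an algebra over the field of constants, whose elements commute with `t`. -/
noncomputable instance : Algebra (constField δ) (DiffPoly δ) :=
  RingHom.toAlgebra' ((C δ).comp (constField δ).subtype) (by
    intro c f
    have hc : δ (c : K) = 0 := c.2
    have ht : Commute (C δ (c : K)) (t δ) := by
      have := t_mul_C δ (c : K)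
      rw [hc, map_zero, add_zero] at this
      exact this.symm
    change Commute (C δ (c : K)) f
    rw [eq_sum δ f, Polynomial.sum]
    refine Commute.sum_right _ _ _ fun i _ => Commute.mul_right ?_ (ht.pow_right i)
    change _ * _ = _ * _
    rw [← map_mul, ← map_mul, mul_comm])

variable {δ} in
/-- The degree of a skew polynomial (with value `0` at `0`). -/
noncomputable def natDegree (f : DiffPoly δ) : ℕ := (toPoly f).natDegree

variable {δ} in
/-- The leading coefficient `aₘ` of a skew polynomial `a₀ + a₁ t + ⋯ + aₘ tᵐ` of degree `m`. -/
noncomputable def leadingCoeff (f : DiffPoly δ) : K := (toPoly f).leadingCoeff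

theorem coeff_tMul (f : K[X]) (n : ℕ) :
    (tMul δ f).coeff (n + 1) = f.coeff n + δ (f.coeff (n + 1)) := by
  induction f using Polynomial.induction_on' with
  | add p q hp hq => simp only [map_add, coeff_add, hp, hq]; abel
  | monomial i b =>
    rw [tMul_monomial]
    simp only [coeff_add, coeff_monomial, add_left_inj]
    congr 1
    split_ifs <;> simp

theorem coeff_tMul_pow (f : K[X]) (n : ℕ) (hf : f.natDegree ≤ n) (i : ℕ) :
    (tMul δ ^ i) f ∈ degreeLE K ((n + i : ℕ) : WithBot ℕ) ∧
      ((tMul δ ^ i) f).coeff (n + i) = f.coeff n := by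
  induction i with
  | zero => simpa [mem_degreeLE] using natDegree_le_iff_degree_le.1 hf
  | succ i ih =>
    obtain ⟨h1, h2⟩ := ih
    rw [mem_degreeLE, ← natDegree_le_iff_degree_le, natDegree_le_iff_coeff_eq_zero] at h1 ⊢
    rw [pow_succ', Module.End.mul_apply]
    constructor
    · intro N hN
      obtain ⟨N, rfl⟩ : ∃ M, N = M + 1 := ⟨N - 1, by omega⟩
      rw [coeff_tMul, h1 N (by omega), h1 (N + 1) (by omega), map_zero, add_zero]
    · rw [← add_assoc, coeff_tMul, h2, h1 (n + i + 1) (by omega), map_zero, add_zero]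

/-- The coefficient of `tᵐ⁺ⁿ` in a product is the product of the leading coefficients. -/
theorem coeff_mul_degree (f g : DiffPoly δ) :
    (toPoly (f * g)).coeff (f.natDegree + g.natDegree) = f.leadingCoeff * g.leadingCoeff := by
  rw [toPoly_mul, leftMul, eval₂_eq_sum, Polynomial.sum]
  rw [LinearMap.sum_apply, finsetSum_coeff]
  rw [Finset.sum_eq_single f.natDegree]
  · change ((toPoly f).coeff f.natDegree • (tMul δ ^ f.natDegree) (toPoly g)).coeff _ = _
    rw [coeff_smul, add_comm, (coeff_tMul_pow δ (toPoly g) g.natDegree le_rfl _).2]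
    rfl
  · intro i hi hne
    change ((toPoly f).coeff i • (tMul δ ^ i) (toPoly g)).coeff _ = _
    have hle : i ≤ f.natDegree := le_natDegree_of_mem_supp i hi
    have h := (coeff_tMul_pow δ (toPoly g) g.natDegree le_rfl i).1
    rw [mem_degreeLE, ← natDegree_le_iff_degree_le, natDegree_le_iff_coeff_eq_zero] at h
    rw [coeff_smul, h _ (by omega), smul_zero]
  · intro h
    change ((toPoly f).coeff f.natDegree • (tMul δ ^ f.natDegree) (toPoly g)).coeff _ = _
    rw [notMem_support_iff.1 h]
    simp

instance : NoZeroDivisors (DiffPoly δ) where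
  eq_zero_or_eq_zero_of_mul_eq_zero {f g} h := by
    have := coeff_mul_degree δ f g
    rw [h, map_zero, coeff_zero, eq_comm, mul_eq_zero] at this
    simpa [leadingCoeff] using this

instance : IsDomain (DiffPoly δ) := NoZeroDivisors.to_isDomain _

end DiffPoly

/-! ### The ring of central quotients -/

section CentralQuotients

/-- The ring of central quotients `{f / g | f ∈ R, 0 ≠ g ∈ C(R)}` of a domain `R`, where `C(R)` is
the center of `R`. -/
abbrev CentralQuotients (R : Type*) [Ring R] : Type _ :=
  LocalizedModule (nonZeroDivisors (Subring.center R)) R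

/-- The ring of central quotients is an algebra over the quotient field of the center. -/
noncomputable instance CentralQuotients.instAlgebra (R : Type*) [Ring R] :
    Algebra (FractionRing (Subring.center R)) (CentralQuotients R) :=
  Algebra.ofModule
    (by
      intro r x y
      induction r using Localization.induction_on with | _ r
      induction x using LocalizedModule.induction_on with | _ a s
      induction y using LocalizedModule.induction_on with | _ b u
      rw [LocalizedModule.mk_smul_mk, LocalizedModule.mk_mul_mk, LocalizedModule.mk_mul_mk,
        LocalizedModule.mk_smul_mk, smul_mul_assoc, mul_assoc])
    (by
      intro r x y
      induction r using Localization.induction_on with | _ r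
      induction x using LocalizedModule.induction_on with | _ a s
      induction y using LocalizedModule.induction_on with | _ b u
      rw [LocalizedModule.mk_smul_mk, LocalizedModule.mk_mul_mk, LocalizedModule.mk_mul_mk,
        LocalizedModule.mk_smul_mk, mul_smul_comm, mul_left_comm])

/-- The inclusion `R → CentralQuotients R`, `f ↦ f / 1`. -/
noncomputable def CentralQuotients.of {R : Type*} [Ring R] : R →+* CentralQuotients R :=
  LocalizedModule.numeratorRingHom

end CentralQuotients

/-! ### The reduced norm -/

section ReducedNorm

/-- `c ∈ k` is the reduced norm of the element `a` of the `k`-algebra `A`: there is an isomorphism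
of `k̄`-algebras from `k̄ ⊗ A` to a matrix algebra `Mₙ(k̄)`, where `k̄` is an algebraic closure
of `k`, that sends `1 ⊗ a` to a matrix of determinant `c`. -/
def IsReducedNormOf {k A : Type*} [Field k] [Ring A] [Algebra k A] (a : A) (c : k) : Prop :=
  ∃ (n : ℕ) (φ : AlgebraicClosure k ⊗[k] A ≃ₐ[AlgebraicClosure k]
      Matrix (Fin n) (Fin n) (AlgebraicClosure k)),
    (φ (1 ⊗ₜ a)).det = algebraMap k (AlgebraicClosure k) c

/-- The reduced norm of an element is well defined. -/
theorem IsReducedNormOf.unique {k A : Type*} [Field k] [Ring A] [Algebra k A] {a : A} {c c' : k}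
    (h : IsReducedNormOf a c) (h' : IsReducedNormOf a c') : c = c' := by
  obtain ⟨n, φ, h⟩ := h
  obtain ⟨n', φ', h'⟩ := h'
  have : n = n' := by
    have := (φ.symm.trans φ').toLinearEquiv.finrank_eq
    simp [Module.finrank_matrix] at this
    nlinarith
  subst this
  let ψ := ((algEquivMatrix' (R := AlgebraicClosure k) (n := Fin n)).trans
    (φ.symm.trans φ')).trans (algEquivMatrix').symm
  obtain ⟨T, hT⟩ := ψ.eq_linearEquivConjAlgEquiv
  have h1 : ψ ((algEquivMatrix').symm (φ (1 ⊗ₜ a))) = (algEquivMatrix').symm (φ' (1 ⊗ₜ a)) := by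
    simp [ψ]
  rw [hT] at h1
  have h2 := congrArg LinearMap.det h1
  apply (algebraMap k (AlgebraicClosure k)).injective
  rw [← h, ← h']
  have h3 : ∀ M : Matrix (Fin n) (Fin n) (AlgebraicClosure k),
      LinearMap.det (algEquivMatrix'.symm M) = M.det := fun M => LinearMap.det_toLin' M
  rw [h3] at h2
  rw [← h2, ← h3]
  exact (LinearMap.det_conj _ T).symm

open Classical in
/-- The reduced norm `A → k` of a finite-dimensional central simple `k`-algebra `A` (the junk value
`0` is used if `A` is not such an algebra). -/
noncomputable def reducedNorm (k : Type*) {A : Type*} [Field k] [Ring A] [Algebra k A] (a : A) : k :=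
  if h : ∃ c : k, IsReducedNormOf a c then h.choose else 0

end ReducedNorm

/-! ### The norm of `K(t; δ)` -/

namespace DiffPoly

variable {K : Type*} [Field K] (δ : Derivation ℤ K K)

/-- The element `x = g(t)` of `K[t; δ]`, where `g` is the minimum polynomial of `δ`. -/
noncomputable def x : DiffPoly δ := aeval (t δ) (derivMinpoly δ)

variable {δ} in
/-- The norm `N(f)` of `f ∈ K[t; δ]`: the reduced norm of `f` in the ring `K(t; δ)` of central
quotients of `K[t; δ]`, as an algebra over the quotient field of the center of `K[t; δ]`. -/
noncomputable def norm (f : DiffPoly δ) : FractionRing (Subring.center (DiffPoly δ)) :=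
  reducedNorm (FractionRing (Subring.center (DiffPoly δ))) (CentralQuotients.of f)

end DiffPoly

/-! Write n for the degree of g. The powers 1, t, …, t^(n-1) form a basis of R as a left
K[x]-module, and right multiplication by f gives an n × n matrix M(f) over K[x] (`toMatrix`). The
norm of f turns out to be det M(f), and both claims are read off this matrix.

Minimality of g among all skew polynomials killing K, not only those with constant coefficients
(`eq_zero_of_act_eq_zero`), makes x central, identifies the center with F[x], and makes suitable
Wronskians invertible.

The determinant lies in F[x] because differentiating the coefficients of M(f) gives its commutator
with M(t) (`map_derivX_toMatrix`). To first order in ε, M(f) + M(f)'ε is therefore conjugate to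
M(f), so the characteristic polynomial has constants as coefficients. Cayley–Hamilton, pulled back
to R along the injective map M, then exhibits det M(f) as a two-sided multiple of f.

For the leading term, row i of M(f) holds the coordinates of t^i f, of degree m + i in t, where x^k
t^j has degree nk + j. Summing these degrees over a permutation shows that only the cyclic shift by
m reaches x^m (`Matrix.det_leading_term`).

Finally M splits K(t;δ). In characteristic p, K[x] is integral over F[x] and so maps to the
algebraic closure of F(x). The n² elements bⱼ t^l, for bⱼ with nonzero Wronskian, span the scalar
extension and have linearly independent images. Hence the map to n × n matrices is an isomorphism
(`exists_algEquiv_matrix`). -/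

namespace DiffPoly

/-! ### Degrees and leading coefficients of skew polynomials. -/

section Degree

variable {K : Type*} [Field K] {δ : Derivation ℤ K K}

theorem natDegree_mul_le (f g : DiffPoly δ) : (f * g).natDegree ≤ f.natDegree + g.natDegree := by
  rw [natDegree, natDegree_le_iff_coeff_eq_zero]
  intro k hk
  rw [toPoly_mul, leftMul, eval₂_eq_sum, Polynomial.sum, LinearMap.sum_apply, finsetSum_coeff]
  refine Finset.sum_eq_zero fun i hi => ?_
  change ((toPoly f).coeff i • (tMul δ ^ i) (toPoly g)).coeff k = _
  have hle : i ≤ f.natDegree := le_natDegree_of_mem_supp i hi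
  have h := (coeff_tMul_pow δ (toPoly g) g.natDegree le_rfl i).1
  rw [mem_degreeLE, ← natDegree_le_iff_degree_le, natDegree_le_iff_coeff_eq_zero] at h
  rw [coeff_smul, h _ (by omega), smul_zero]

theorem toPoly_eq_zero {f : DiffPoly δ} : toPoly f = 0 ↔ f = 0 :=
  (toPoly (δ := δ)).map_eq_zero_iff

theorem leadingCoeff_ne_zero {f : DiffPoly δ} (hf : f ≠ 0) : f.leadingCoeff ≠ 0 :=
  Polynomial.leadingCoeff_ne_zero.2 (toPoly_eq_zero.not.2 hf)

theorem natDegree_mul {f g : DiffPoly δ} (hf : f ≠ 0) (hg : g ≠ 0) :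
    (f * g).natDegree = f.natDegree + g.natDegree := by
  refine le_antisymm (natDegree_mul_le f g) (Polynomial.le_natDegree_of_ne_zero ?_)
  rw [coeff_mul_degree]
  exact mul_ne_zero (leadingCoeff_ne_zero hf) (leadingCoeff_ne_zero hg)

theorem leadingCoeff_zero : (0 : DiffPoly δ).leadingCoeff = 0 := Polynomial.leadingCoeff_zero

theorem natDegree_zero : (0 : DiffPoly δ).natDegree = 0 := Polynomial.natDegree_zero

theorem leadingCoeff_mul (f g : DiffPoly δ) :
    (f * g).leadingCoeff = f.leadingCoeff * g.leadingCoeff := by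
  by_cases hf : f = 0
  · simp [hf, leadingCoeff_zero]
  by_cases hg : g = 0
  · simp [hg, leadingCoeff_zero]
  rw [← coeff_mul_degree, ← natDegree_mul hf hg]
  rfl

theorem natDegree_C (a : K) : (C δ a).natDegree = 0 := Polynomial.natDegree_C a

theorem leadingCoeff_C (a : K) : (C δ a).leadingCoeff = a := Polynomial.leadingCoeff_C a

theorem toPoly_t_pow (i : ℕ) : toPoly (t δ ^ i) = X ^ i := by
  simpa [monomial_one_right_eq_X_pow] using toPoly_C_mul_t_pow δ 1 i

theorem natDegree_t_pow (i : ℕ) : (t δ ^ i).natDegree = i := by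
  rw [natDegree, toPoly_t_pow, natDegree_X_pow]

theorem leadingCoeff_t_pow (i : ℕ) : (t δ ^ i).leadingCoeff = 1 := by
  rw [leadingCoeff, toPoly_t_pow, leadingCoeff_X_pow]

theorem t_pow_ne_zero (i : ℕ) : t δ ^ i ≠ 0 := by
  rw [Ne, ← toPoly_eq_zero, toPoly_t_pow]
  exact pow_ne_zero _ X_ne_zero

/-- Two skew polynomials with the same leading term differ by one of smaller degree. -/
theorem degree_sub_lt {f g : DiffPoly δ} (hf : f ≠ 0) (hg : g ≠ 0)
    (h : f.natDegree = g.natDegree) (hc : f.leadingCoeff = g.leadingCoeff) :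
    (toPoly (f - g)).degree < (toPoly f).degree := by
  have hf' := toPoly_eq_zero.not.2 hf
  have hg' := toPoly_eq_zero.not.2 hg
  rw [map_sub]
  refine Polynomial.degree_sub_lt_left ?_ hf' hc
  rw [degree_eq_natDegree hf', degree_eq_natDegree hg']
  exact congrArg _ h

/-- Induction on the number of leading terms. -/
theorem induction_degree {P : DiffPoly δ → Prop}
    (h : ∀ f, (∀ g, (toPoly g).degree < (toPoly f).degree → P g) → P f) (f : DiffPoly δ) : P f :=
  (InvImage.wf (fun f : DiffPoly δ => (toPoly f).degree) wellFounded_lt).induction f h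

end Degree

/-! ### Homomorphisms out of the differential polynomial ring. -/

section Lift

variable {K : Type*} [Field K] (δ : Derivation ℤ K K)

/-- The universal property of `K[t; δ]`. -/
noncomputable def lift {S : Type*} [Ring S] (σ : K →+* S) (τ : S)
    (h : ∀ a, τ * σ a = σ a * τ + σ (δ a)) : DiffPoly δ →+* S where
  toFun f := (toPoly f).eval₂ σ τ
  map_one' := eval₂_one _ _
  map_zero' := eval₂_zero _ _
  map_add' f g := eval₂_add _ _
  map_mul' f g := by
    have ht : ∀ g : K[X], (tMul δ g).eval₂ σ τ = τ * g.eval₂ σ τ := by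
      intro g
      induction g using Polynomial.induction_on' with
      | add p q hp hq => simp only [map_add, eval₂_add, hp, hq, mul_add]
      | monomial i b =>
        rw [tMul_monomial, eval₂_add]
        simp only [eval₂_monomial]
        rw [← mul_assoc, h, pow_succ', add_mul, mul_assoc (σ b)]
    have htp : ∀ (i : ℕ) (g : K[X]), ((tMul δ ^ i) g).eval₂ σ τ = τ ^ i * g.eval₂ σ τ := by
      intro i g
      induction i with
      | zero => simp
      | succ i ih => rw [pow_succ', Module.End.mul_apply, ht, ih, pow_succ', mul_assoc]
    rw [toPoly_mul]
    generalize toPoly f = f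
    generalize toPoly g = g
    induction f using Polynomial.induction_on' with
    | add p q hp hq => rw [leftMul_add, LinearMap.add_apply, eval₂_add, hp, hq, eval₂_add, add_mul]
    | monomial i b =>
      rw [leftMul_monomial, eval₂_monomial, mul_assoc, ← htp]
      change (b • (tMul δ ^ i) g).eval₂ σ τ = _
      rw [eval₂_smul]

theorem lift_C {S : Type*} [Ring S] (σ : K →+* S) (τ : S)
    (h : ∀ a, τ * σ a = σ a * τ + σ (δ a)) (a : K) : lift δ σ τ h (C δ a) = σ a := eval₂_C _ _

theorem lift_t {S : Type*} [Ring S] (σ : K →+* S) (τ : S)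
    (h : ∀ a, τ * σ a = σ a * τ + σ (δ a)) : lift δ σ τ h (t δ) = τ := eval₂_X _ _

theorem lift_apply {S : Type*} [Ring S] (σ : K →+* S) (τ : S)
    (h : ∀ a, τ * σ a = σ a * τ + σ (δ a)) (f : DiffPoly δ) :
    lift δ σ τ h f = (toPoly f).eval₂ σ τ := rfl

end Lift

/-! ### Skew polynomials as differential operators on K. -/

section Action

variable {K : Type*} [Field K] (δ : Derivation ℤ K K)

/-- The action of `K[t; δ]` on `K` in which `t` acts as `δ`. -/
noncomputable def act : DiffPoly δ →+* Module.End ℤ K :=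
  lift δ (Module.toModuleEnd ℤ K) δ.toLinearMap (fun a => by
    ext b
    change δ (a * b) = a * δ b + δ a * b
    rw [Derivation.leibniz, smul_eq_mul, smul_eq_mul, mul_comm b])

theorem act_C (a b : K) : act δ (C δ a) b = a * b := by
  rw [act, lift_C]
  rfl

theorem act_t (b : K) : act δ (t δ) b = δ b := by
  rw [act, lift_t]
  rfl

theorem act_t_pow (i : ℕ) (b : K) : act δ (t δ ^ i) b = (δ^[i]) b := by
  induction i with
  | zero => simp
  | succ i ih =>
    rw [pow_succ', map_mul, Module.End.mul_apply, ih, act_t, Function.iterate_succ_apply']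

variable {δ} in
theorem algebraMap_eq (c : constField δ) : algebraMap (constField δ) (DiffPoly δ) c = C δ c := rfl

/-- The skew polynomial with coefficients in the field of constants obtained by substituting `t`. -/
theorem toPoly_aeval_t (q : (constField δ)[X]) :
    toPoly (aeval (t δ) q) = q.map (constField δ).subtype := by
  induction q using Polynomial.induction_on' with
  | add p q hp hq => simp only [map_add, Polynomial.map_add, hp, hq]
  | monomial i b =>
    rw [aeval_monomial, map_monomial, algebraMap_eq, toPoly_C_mul_t_pow]
    rfl

theorem act_aeval_t (q : (constField δ)[X]) (b : K) :
    act δ (aeval (t δ) q) b = aeval (derivEnd δ) q b := by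
  induction q using Polynomial.induction_on' with
  | add p q hp hq => simp only [map_add, LinearMap.add_apply, hp, hq]
  | monomial i c =>
    rw [aeval_monomial, aeval_monomial, algebraMap_eq, map_mul, Module.End.mul_apply,
      act_C, act_t_pow, Module.End.mul_apply, Module.algebraMap_end_apply, Subfield.smul_def,
      smul_eq_mul]
    congr 1
    induction i with
    | zero => rfl
    | succ i ih =>
      rw [Function.iterate_succ_apply', ih, pow_succ', Module.End.mul_apply]
      rfl

theorem mem_constField_of_commute {a : K} (h : Commute (t δ) (C δ a)) : a ∈ constField δ := by
  have := t_mul_C δ a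
  rw [h.eq, left_eq_add] at this
  exact Polynomial.C_eq_zero.1 this

/-- The commutator with `t` acts on the coefficients by `δ`. -/
theorem coeff_t_mul_sub_mul_t (f : DiffPoly δ) (i : ℕ) :
    (toPoly (t δ * f - f * t δ)).coeff i = δ ((toPoly f).coeff i) := by
  -- Coefficients stand on the left, so right multiplication by `t` only shifts them; every
  -- derivative comes from `t * f`.
  have h : f * t δ = ofPoly δ (X * toPoly f) := by
    conv_lhs => rw [eq_sum δ f]
    apply (toPoly (δ := δ)).injective
    rw [Polynomial.sum, Finset.sum_mul, map_sum]
    simp only [mul_assoc, ← pow_succ, toPoly_C_mul_t_pow]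
    change _ = X * toPoly f
    conv_rhs => rw [(toPoly f).as_sum_support, Finset.mul_sum]
    simp only [X_mul_monomial]
  rw [h, map_sub, toPoly_t_mul]
  change (tMul δ (toPoly f) - X * toPoly f).coeff i = _
  rw [coeff_sub]
  cases i with
  | succ i => rw [coeff_tMul, coeff_X_mul, add_sub_cancel_left]
  | zero =>
    generalize toPoly f = f
    rw [coeff_X_mul_zero, sub_zero]
    induction f using Polynomial.induction_on' with
    | add p q hp hq => simp only [map_add, coeff_add, hp, hq]
    | monomial i b =>
      rw [tMul_monomial]
      simp only [coeff_add, coeff_monomial]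
      by_cases hi : i = 0 <;> simp [hi]

end Action

end DiffPoly

namespace DiffPoly

/-! ### Minimality of g among annihilators of K, and centrality of x. -/

section Center

variable {K : Type*} [Field K] (δ : Derivation ℤ K K)

variable {δ} in
theorem exists_aeval_t_eq {f : DiffPoly δ} (h : ∀ i, (toPoly f).coeff i ∈ constField δ) :
    ∃ q : (constField δ)[X], aeval (t δ) q = f := by
  have : toPoly f ∈ Polynomial.lifts (constField δ).subtype :=
    (Polynomial.lifts_iff_coeff_lifts _).2 fun i => ⟨⟨_, h i⟩, rfl⟩
  obtain ⟨q, hq⟩ := (Polynomial.mem_lifts _).1 this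
  exact ⟨q, (toPoly (δ := δ)).injective (by rw [toPoly_aeval_t, hq])⟩

variable {δ} in
theorem degree_C_mul {a : K} (ha : a ≠ 0) (f : DiffPoly δ) :
    (toPoly (C δ a * f)).degree = (toPoly f).degree := by
  rw [toPoly_C_mul, smul_eq_C_mul, Polynomial.degree_C_mul ha]

variable {δ} in
-- The commutator differentiates each coefficient, and the derivative of the leading coefficient 1
-- is 0.
theorem degree_t_mul_sub_mul_t_lt {f : DiffPoly δ} (hf : (toPoly f).Monic) :
    (toPoly (t δ * f - f * t δ)).degree < (toPoly f).degree := by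
  refine lt_of_le_of_ne (degree_le_iff_coeff_zero _ _ |>.2 fun i hi => ?_) fun h => ?_
  · rw [coeff_t_mul_sub_mul_t, coeff_eq_zero_of_degree_lt hi, map_zero]
  · have h1 := coeff_t_mul_sub_mul_t δ f (toPoly f).natDegree
    rw [hf.coeff_natDegree, Derivation.map_one_eq_zero, ← natDegree_eq_of_degree_eq h,
      coeff_natDegree, Polynomial.leadingCoeff_eq_zero] at h1
    rw [h1, degree_zero, eq_comm, degree_eq_bot] at h
    exact hf.ne_zero h

variable {δ} in
/-- No skew polynomial of degree less than that of the minimum polynomial of `δ` annihilates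
`K`. -/
theorem eq_zero_of_act_eq_zero (f : DiffPoly δ) (hf : act δ f = 0)
    (hd : (toPoly f).degree < (derivMinpoly δ).degree) : f = 0 := by
  induction f using induction_degree with | h f ih => ?_
  by_contra h0
  have hc : f.leadingCoeff⁻¹ ≠ 0 := inv_ne_zero (leadingCoeff_ne_zero h0)
  have hdeg := degree_C_mul hc f
  have hact : act δ (C δ f.leadingCoeff⁻¹ * f) = 0 := by rw [map_mul, hf, mul_zero]
  have hmon : (toPoly (C δ f.leadingCoeff⁻¹ * f)).Monic := by
    change leadingCoeff _ = 1
    rw [leadingCoeff_mul, leadingCoeff_C, inv_mul_cancel₀ (leadingCoeff_ne_zero h0)]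
  generalize C δ f.leadingCoeff⁻¹ * f = f' at *
  have hlt := degree_t_mul_sub_mul_t_lt hmon
  -- The commutator with `t` again kills K and has smaller degree, so it vanishes by induction. The
  -- coefficients of `f'` are then constants, and the minimality of the minimum polynomial over F
  -- applies.
  have hz := ih (t δ * f' - f' * t δ) (hdeg ▸ hlt)
    (by rw [map_sub, map_mul, map_mul, hact, mul_zero, zero_mul, sub_zero])
    (hlt.trans (hdeg ▸ hd))
  obtain ⟨q, rfl⟩ := exists_aeval_t_eq (f := f') fun i => by
    rw [mem_constField, ← coeff_t_mul_sub_mul_t, hz, map_zero, coeff_zero]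
  rw [toPoly_aeval_t, degree_map_eq_of_injective Subtype.val_injective] at hdeg
  have hq : q ≠ 0 := by
    rintro rfl
    simp at hmon
  have haeval : aeval (derivEnd δ) q = 0 := by
    ext b
    rw [← act_aeval_t, hact]
    rfl
  have := minpoly.degree_le_of_ne_zero (constField δ) (derivEnd δ) hq haeval
  exact absurd hd (not_lt.2 (hdeg ▸ this))

theorem act_x : act δ (x δ) = 0 := by
  ext b
  rw [x, act_aeval_t, derivMinpoly, minpoly.aeval]
  rfl

theorem toPoly_x : toPoly (x δ) = (derivMinpoly δ).map (constField δ).subtype :=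
  toPoly_aeval_t δ _

theorem natDegree_x : (x δ).natDegree = (derivMinpoly δ).natDegree := by
  rw [natDegree, toPoly_x, natDegree_map]

theorem degree_x : (toPoly (x δ)).degree = (derivMinpoly δ).degree := by
  rw [toPoly_x, degree_map]

theorem commute_t_x : Commute (t δ) (x δ) := by
  rw [x]
  have := (Commute.all (X : (constField δ)[X]) (derivMinpoly δ)).map (aeval (t δ))
  rwa [aeval_X] at this

theorem commute_of_commute_t_of_commute_C {f : DiffPoly δ} (ht : Commute (t δ) f)
    (hC : ∀ a, Commute (C δ a) f) (g : DiffPoly δ) : Commute g f := by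
  rw [eq_sum δ g, Polynomial.sum]
  exact Commute.sum_left _ _ _ fun i _ => (hC _).mul_left (ht.pow_left i)

variable {δ}
-- Since K is commutative, the two products have the same leading term.
theorem degree_sub_commutator {f : DiffPoly δ} (a : K) (hf : f ≠ 0) :
    (toPoly (f * C δ a - C δ a * f)).degree < (toPoly f).degree := by
  by_cases ha : a = 0
  · rw [ha]
    simpa [bot_lt_iff_ne_bot, degree_eq_bot, toPoly_eq_zero] using hf
  have hC : C δ a ≠ 0 := by simpa using ha
  have h := degree_sub_lt (mul_ne_zero hf hC) (mul_ne_zero hC hf)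
    (by rw [natDegree_mul hf hC, natDegree_mul hC hf, add_comm])
    (by rw [leadingCoeff_mul, leadingCoeff_mul, mul_comm])
  refine h.trans_eq ?_
  rw [degree_eq_natDegree (toPoly_eq_zero.not.2 (mul_ne_zero hf hC)),
    degree_eq_natDegree (toPoly_eq_zero.not.2 hf)]
  have := natDegree_mul hf hC
  rw [natDegree_C, add_zero] at this
  exact congrArg _ this

variable (hδ : IsAlgebraic (constField δ) (derivEnd δ))
include hδ

theorem monic_derivMinpoly : (derivMinpoly δ).Monic := minpoly.monic hδ.isIntegral

theorem leadingCoeff_x : (x δ).leadingCoeff = 1 := by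
  rw [leadingCoeff, toPoly_x, ← Monic.def]
  exact (monic_derivMinpoly hδ).map _

theorem x_ne_zero : x δ ≠ 0 := fun h => by
  have := leadingCoeff_x hδ
  rw [h, leadingCoeff_zero] at this
  exact zero_ne_one this

theorem natDegree_derivMinpoly_pos : 0 < (derivMinpoly δ).natDegree :=
  minpoly.natDegree_pos hδ.isIntegral

/-- The commutator of x with an element of K kills K and has degree below that of g, so it is 0;
with `t`, x commutes because its coefficients are constants. -/
theorem commute_x (f : DiffPoly δ) : Commute f (x δ) := by
  refine commute_of_commute_t_of_commute_C δ (commute_t_x δ) (fun a => ?_) f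
  have := eq_zero_of_act_eq_zero (x δ * C δ a - C δ a * x δ)
    (by rw [map_sub, map_mul, map_mul, act_x, mul_zero, zero_mul, sub_zero])
    (degree_x δ ▸ degree_sub_commutator a (x_ne_zero hδ))
  exact (sub_eq_zero.1 this).symm

end Center

end DiffPoly

namespace DiffPoly

/-! ### Leading terms of powers and sums. -/

section Sum

variable {K : Type*} [Field K] {δ : Derivation ℤ K K}

theorem leadingCoeff_one : (1 : DiffPoly δ).leadingCoeff = 1 := Polynomial.leadingCoeff_one

theorem natDegree_one : (1 : DiffPoly δ).natDegree = 0 := Polynomial.natDegree_one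

theorem leadingCoeff_pow (f : DiffPoly δ) (i : ℕ) :
    (f ^ i).leadingCoeff = f.leadingCoeff ^ i := by
  induction i with
  | zero => simp [leadingCoeff_one]
  | succ i ih => rw [pow_succ, leadingCoeff_mul, ih, pow_succ]

theorem natDegree_pow (f : DiffPoly δ) (i : ℕ) : (f ^ i).natDegree = i * f.natDegree := by
  by_cases hf : f = 0
  · cases i <;> simp [hf, natDegree_zero, natDegree_one]
  induction i with
  | zero => simp [natDegree_one]
  | succ i ih => rw [pow_succ, natDegree_mul (pow_ne_zero _ hf) hf, ih, add_mul, one_mul]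

/-- The leading term of a sum with a dominating summand. -/
theorem natDegree_sum_of_lt {ι : Type*} (s : Finset ι) (f : ι → DiffPoly δ) {k : ι} (hk : k ∈ s)
    (hfk : f k ≠ 0) (h : ∀ i ∈ s, i ≠ k → f i ≠ 0 → (f i).natDegree < (f k).natDegree) :
    (∑ i ∈ s, f i).natDegree = (f k).natDegree ∧
      (∑ i ∈ s, f i).leadingCoeff = (f k).leadingCoeff := by
  classical
  have hd : (toPoly (∑ i ∈ s.erase k, f i)).degree < (toPoly (f k)).degree := by
    rw [degree_eq_natDegree (toPoly_eq_zero.not.2 hfk), ← mem_degreeLT, map_sum]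
    refine Submodule.sum_mem _ fun i hi => ?_
    obtain ⟨hik, his⟩ := Finset.mem_erase.1 hi
    by_cases hfi : f i = 0
    · rw [hfi, map_zero]
      exact zero_mem _
    · rw [mem_degreeLT, degree_eq_natDegree (toPoly_eq_zero.not.2 hfi)]
      exact_mod_cast h i his hik hfi
  rw [← Finset.add_sum_erase _ _ hk]
  constructor
  · rw [natDegree, map_add]
    exact natDegree_eq_of_degree_eq (degree_add_eq_left_of_degree_lt hd)
  · rw [leadingCoeff, map_add]
    exact leadingCoeff_add_of_degree_lt' hd

end Sum

/-! ### The x-adic expansion. -/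

section Expansion

variable {K : Type*} [Field K] {δ : Derivation ℤ K K}
variable (hδ : IsAlgebraic (constField δ) (derivEnd δ))

/-- The inclusion `K[x] → K[t; δ]`. -/
noncomputable def inclX : K[X] →+* DiffPoly δ :=
  eval₂RingHom' (C δ) (x δ) fun _ => commute_x hδ _

theorem inclX_C (a : K) : inclX hδ (Polynomial.C a) = C δ a := eval₂_C _ _

theorem inclX_X : inclX hδ X = x δ := eval₂_X _ _

theorem inclX_apply (P : K[X]) : inclX hδ P = ∑ i ∈ P.support, C δ (P.coeff i) * x δ ^ i := by
  change P.eval₂ _ _ = _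
  rw [eval₂_eq_sum, Polynomial.sum]

theorem inclX_map (P : (constField δ)[X]) :
    inclX hδ (P.map (constField δ).subtype) = aeval (x δ) P := by
  change eval₂ _ _ _ = _
  rw [eval₂_map, aeval_def]
  rfl

theorem inclX_natDegree_leadingCoeff {P : K[X]} (hP : P ≠ 0) :
    (inclX hδ P).natDegree = (derivMinpoly δ).natDegree * P.natDegree ∧
      (inclX hδ P).leadingCoeff = P.leadingCoeff := by
  have hx := x_ne_zero hδ
  have hC : ∀ i ∈ P.support, C δ (P.coeff i) ≠ 0 := fun i hi => by simpa using hi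
  have hd : ∀ i ∈ P.support, (C δ (P.coeff i) * x δ ^ i).natDegree =
      (derivMinpoly δ).natDegree * i := fun i hi => by
    rw [natDegree_mul (hC i hi) (pow_ne_zero _ hx), natDegree_C, natDegree_pow, natDegree_x,
      zero_add, mul_comm]
  have hm : P.natDegree ∈ P.support := natDegree_mem_support_of_nonzero hP
  have key := natDegree_sum_of_lt P.support (fun i => C δ (P.coeff i) * x δ ^ i) hm
    (mul_ne_zero (hC _ hm) (pow_ne_zero _ hx)) fun i hi hne _ => by
      rw [hd i hi, hd _ hm]
      exact Nat.mul_lt_mul_of_pos_left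
        (lt_of_le_of_ne (le_natDegree_of_mem_supp i hi) hne) (natDegree_derivMinpoly_pos hδ)
  rw [inclX_apply, key.1, key.2, hd _ hm, leadingCoeff_mul, leadingCoeff_C, leadingCoeff_pow,
    leadingCoeff_x hδ, one_pow, mul_one]
  exact ⟨rfl, rfl⟩

theorem inclX_ne_zero {P : K[X]} (hP : P ≠ 0) : inclX hδ P ≠ 0 := fun h => by
  have := (inclX_natDegree_leadingCoeff hδ hP).2
  rw [h, leadingCoeff_zero] at this
  exact hP (Polynomial.leadingCoeff_eq_zero.1 this.symm)

/-- The skew polynomial `∑ vⱼ(x) tʲ` with `j` less than the degree of the minimum polynomial. -/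
noncomputable def ofCoords : (Fin (derivMinpoly δ).natDegree → K[X]) →+ DiffPoly δ where
  toFun v := ∑ j, inclX hδ (v j) * t δ ^ (j : ℕ)
  map_zero' := by simp
  map_add' v w := by simp [add_mul, Finset.sum_add_distrib]

theorem ofCoords_apply (v : Fin (derivMinpoly δ).natDegree → K[X]) :
    ofCoords hδ v = ∑ j, inclX hδ (v j) * t δ ^ (j : ℕ) := rfl

theorem ofCoords_single [DecidableEq (Fin (derivMinpoly δ).natDegree)]
    (j : Fin (derivMinpoly δ).natDegree) (P : K[X]) :
    ofCoords hδ (Pi.single j P) = inclX hδ P * t δ ^ (j : ℕ) := by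
  rw [ofCoords_apply, Finset.sum_eq_single j]
  · rw [Pi.single_eq_same]
  · intro i _ hi
    rw [Pi.single_eq_of_ne hi, map_zero, zero_mul]
  · simp

theorem natDegree_inclX_mul_t_pow {P : K[X]} (hP : P ≠ 0) (j : ℕ) :
    (inclX hδ P * t δ ^ j).natDegree = (derivMinpoly δ).natDegree * P.natDegree + j := by
  rw [natDegree_mul (inclX_ne_zero hδ hP) (t_pow_ne_zero j), natDegree_t_pow,
    (inclX_natDegree_leadingCoeff hδ hP).1]

theorem leadingCoeff_inclX_mul_t_pow {P : K[X]} (hP : P ≠ 0) (j : ℕ) :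
    (inclX hδ P * t δ ^ j).leadingCoeff = P.leadingCoeff := by
  rw [leadingCoeff_mul, leadingCoeff_t_pow, (inclX_natDegree_leadingCoeff hδ hP).2, mul_one]

/-- The leading term of `∑ vⱼ(x) tʲ`. -/
theorem ofCoords_leading {v : Fin (derivMinpoly δ).natDegree → K[X]} (hv : v ≠ 0) :
    (∃ k, v k ≠ 0 ∧
      (ofCoords hδ v).natDegree = (derivMinpoly δ).natDegree * (v k).natDegree + k ∧
      (ofCoords hδ v).leadingCoeff = (v k).leadingCoeff) ∧
    ∀ j, v j ≠ 0 →
      (derivMinpoly δ).natDegree * (v j).natDegree + j ≤ (ofCoords hδ v).natDegree := by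
  classical
  obtain ⟨j₀, hj₀⟩ := Function.ne_iff.1 hv
  obtain ⟨k, hk, hmax⟩ := Finset.exists_max_image (Finset.univ.filter fun j => v j ≠ 0)
    (fun j => (derivMinpoly δ).natDegree * (v j).natDegree + j) ⟨j₀, by simpa using hj₀⟩
  simp only [Finset.mem_filter, Finset.mem_univ, true_and] at hk hmax
  have hne : ∀ {j}, v j ≠ 0 → inclX hδ (v j) * t δ ^ (j : ℕ) ≠ 0 := fun h =>
    mul_ne_zero (inclX_ne_zero hδ h) (t_pow_ne_zero _)
  have key := natDegree_sum_of_lt Finset.univ (fun j => inclX hδ (v j) * t δ ^ (j : ℕ))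
    (Finset.mem_univ k) (hne hk) fun i _ hik hi => by
      have hvi : v i ≠ 0 := fun h => hi (by rw [h, map_zero, zero_mul])
      rw [natDegree_inclX_mul_t_pow hδ hvi, natDegree_inclX_mul_t_pow hδ hk]
      -- The residue of the degree modulo n recovers the index j, so distinct summands never have
      -- equal degrees.
      refine lt_of_le_of_ne (hmax i hvi) fun h => hik (Fin.ext ?_)
      have := congrArg (· % (derivMinpoly δ).natDegree) h
      simpa [Nat.mul_add_mod, Nat.mod_eq_of_lt] using this
  rw [natDegree_inclX_mul_t_pow hδ hk, leadingCoeff_inclX_mul_t_pow hδ hk] at key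
  rw [ofCoords_apply, key.1, key.2]
  exact ⟨⟨k, hk, rfl, rfl⟩, hmax⟩

theorem ofCoords_injective : Function.Injective (ofCoords hδ) := by
  rw [injective_iff_map_eq_zero]
  intro v hv
  by_contra h
  obtain ⟨⟨k, hk, -, hl⟩, -⟩ := ofCoords_leading hδ h
  rw [hv, leadingCoeff_zero] at hl
  exact hk (Polynomial.leadingCoeff_eq_zero.1 hl.symm)

/-- A leading term of degree m is cancelled by a multiple of x^(m / n) t^(m mod n), and the degree
drops. -/
theorem ofCoords_surjective : Function.Surjective (ofCoords hδ) := by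
  classical
  intro f
  induction f using induction_degree with | h f ih => ?_
  by_cases hf : f = 0
  · exact ⟨0, by rw [hf, map_zero]⟩
  have hN := natDegree_derivMinpoly_pos hδ
  have hP : monomial (f.natDegree / (derivMinpoly δ).natDegree) f.leadingCoeff ≠ 0 := by
    simpa using leadingCoeff_ne_zero hf
  let j : Fin (derivMinpoly δ).natDegree := ⟨f.natDegree % (derivMinpoly δ).natDegree,
    Nat.mod_lt _ hN⟩
  obtain ⟨v, hv⟩ := ih (f - inclX hδ (monomial (f.natDegree / (derivMinpoly δ).natDegree)
      f.leadingCoeff) * t δ ^ (j : ℕ)) (degree_sub_lt hf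
      (mul_ne_zero (inclX_ne_zero hδ hP) (t_pow_ne_zero _))
      (by
        rw [natDegree_inclX_mul_t_pow hδ hP,
          natDegree_monomial_eq _ (leadingCoeff_ne_zero hf), Nat.div_add_mod])
      (by rw [leadingCoeff_inclX_mul_t_pow hδ hP, leadingCoeff_monomial]))
  exact ⟨v + Pi.single j (monomial (f.natDegree / (derivMinpoly δ).natDegree) f.leadingCoeff),
    by rw [map_add, hv, ofCoords_single, sub_add_cancel]⟩

/-- The `x`-adic expansion: `K[t; δ]` is a free left `K[x]`-module on the powers `tʲ` with `j` less
than the degree of the minimum polynomial. -/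
noncomputable def coords : DiffPoly δ ≃+ (Fin (derivMinpoly δ).natDegree → K[X]) :=
  (AddEquiv.ofBijective _ ⟨ofCoords_injective hδ, ofCoords_surjective hδ⟩).symm

theorem ofCoords_coords (f : DiffPoly δ) : ofCoords hδ (coords hδ f) = f :=
  (coords hδ).symm_apply_apply f

theorem coords_ofCoords (v : Fin (derivMinpoly δ).natDegree → K[X]) :
    coords hδ (ofCoords hδ v) = v :=
  (coords hδ).apply_symm_apply v

theorem coords_inclX_mul (P : K[X]) (f : DiffPoly δ) :
    coords hδ (inclX hδ P * f) = fun j => P * coords hδ f j := by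
  apply ofCoords_injective hδ
  conv_lhs => rw [ofCoords_coords, ← ofCoords_coords hδ f, ofCoords_apply, Finset.mul_sum]
  simp only [ofCoords_apply, map_mul, mul_assoc]

theorem coords_t_pow [DecidableEq (Fin (derivMinpoly δ).natDegree)]
    (j : Fin (derivMinpoly δ).natDegree) : coords hδ (t δ ^ (j : ℕ)) = Pi.single j 1 := by
  apply ofCoords_injective hδ
  rw [ofCoords_coords, ofCoords_single, map_one, one_mul]

end Expansion

/-! ### Division by x and the center. -/

section Center

variable {K : Type*} [Field K] {δ : Derivation ℤ K K}

theorem natDegree_sub_le (f g : DiffPoly δ) :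
    (f - g).natDegree ≤ max f.natDegree g.natDegree := by
  rw [natDegree, map_sub]
  exact Polynomial.natDegree_sub_le _ _

theorem natDegree_t_mul_sub_mul_t_le (f : DiffPoly δ) :
    (t δ * f - f * t δ).natDegree ≤ f.natDegree := by
  rw [natDegree, natDegree_le_iff_coeff_eq_zero]
  intro i hi
  rw [coeff_t_mul_sub_mul_t, coeff_eq_zero_of_natDegree_lt hi, map_zero]

theorem degree_lt_derivMinpoly (hδ : IsAlgebraic (constField δ) (derivEnd δ)) {f : DiffPoly δ}
    (hf : f.natDegree < (derivMinpoly δ).natDegree) :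
    (toPoly f).degree < (derivMinpoly δ).degree := by
  rw [degree_eq_natDegree (monic_derivMinpoly hδ).ne_zero]
  exact degree_le_natDegree.trans_lt (by exact_mod_cast hf)

variable (hδ : IsAlgebraic (constField δ) (derivEnd δ))
include hδ

/-- Division with remainder by `x`. -/
theorem exists_eq_mul_x_add (f : DiffPoly δ) : ∃ q r : DiffPoly δ, f = q * x δ + r ∧
    r.natDegree < (derivMinpoly δ).natDegree := by
  -- Each coordinate is divided by X; the constant terms of the coordinates make up the remainder.
  refine ⟨ofCoords hδ fun j => (coords hδ f j).divX,
    ofCoords hδ fun j => Polynomial.C ((coords hδ f j).coeff 0), ?_, ?_⟩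
  · conv_lhs => rw [← ofCoords_coords hδ f]
    rw [(commute_x hδ _).eq]
    simp only [ofCoords_apply, Finset.mul_sum]
    rw [← Finset.sum_add_distrib]
    refine Finset.sum_congr rfl fun j _ => ?_
    rw [← mul_assoc, ← add_mul, ← inclX_X hδ, ← map_mul, ← map_add, mul_comm X, divX_mul_X_add]
  · by_cases h : (fun j => Polynomial.C ((coords hδ f j).coeff 0)) = 0
    · rw [h, map_zero, natDegree_zero]
      exact natDegree_derivMinpoly_pos hδ
    · obtain ⟨⟨k, -, hk, -⟩, -⟩ := ofCoords_leading hδ h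
      rw [hk, Polynomial.natDegree_C, mul_zero, zero_add]
      exact k.2

theorem eq_zero_of_mul_x_add_eq_zero {q r : DiffPoly δ} (h : q * x δ + r = 0)
    (hr : r.natDegree < (derivMinpoly δ).natDegree) : q = 0 ∧ r = 0 := by
  have hq : q = 0 := by
    by_contra hq
    have h1 := natDegree_mul hq (x_ne_zero hδ)
    rw [eq_neg_of_add_eq_zero_left h, natDegree_x, natDegree, map_neg, natDegree_neg] at h1
    change r.natDegree = _ at h1
    omega
  refine ⟨hq, ?_⟩
  rwa [hq, zero_mul, zero_add] at h

/-- Commuting with K, the operator r is K-linear, hence multiplication by its value at 1. The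
difference from that constant kills K in degree below n, so it is 0. -/
theorem eq_C_of_commute {r : DiffPoly δ} (hC : ∀ a, Commute (C δ a) r)
    (hr : r.natDegree < (derivMinpoly δ).natDegree) : ∃ c, r = C δ c := by
  refine ⟨act δ r 1, sub_eq_zero.1 (eq_zero_of_act_eq_zero _ ?_ (degree_lt_derivMinpoly hδ ?_))⟩
  · ext b
    have h : act δ r b = act δ (r * C δ b) 1 := by
      rw [map_mul, Module.End.mul_apply, act_C, mul_one]
    rw [map_sub, LinearMap.sub_apply, h, ← (hC b).eq, map_mul, Module.End.mul_apply, act_C, act_C,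
      mul_comm, sub_self]
    rfl
  · refine (natDegree_sub_le _ _).trans_lt (max_lt hr ?_)
    rw [natDegree_C]
    exact natDegree_derivMinpoly_pos hδ

/-- The center of `K[t; δ]` is `F[x]`. -/
theorem exists_aeval_x_eq_of_commute {f : DiffPoly δ} (hf : ∀ g, Commute g f) :
    ∃ P : (constField δ)[X], aeval (x δ) P = f := by
  induction hn : f.natDegree using Nat.strong_induction_on generalizing f with | h n ih => ?_
  obtain ⟨q, r, rfl, hr⟩ := exists_eq_mul_x_add hδ f
  -- As x is central, [g, qx + r] = [g, q]x + [g, r], and uniqueness of division by x makes both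
  -- terms vanish.
  have hsplit : ∀ g : DiffPoly δ, (g * r - r * g).natDegree < (derivMinpoly δ).natDegree →
      Commute g q ∧ Commute g r := by
    intro g hg
    have h : (g * q - q * g) * x δ + (g * r - r * g) = 0 := by
      have := (hf g).eq
      rw [mul_add, add_mul, mul_assoc q, ← (commute_x hδ g).eq] at this
      rw [sub_mul, mul_assoc, mul_assoc, ← sub_eq_zero.2 this]
      abel
    obtain ⟨h1, h2⟩ := eq_zero_of_mul_x_add_eq_zero hδ h hg
    exact ⟨sub_eq_zero.1 h1, sub_eq_zero.1 h2⟩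
  have ht := hsplit (t δ) ((natDegree_t_mul_sub_mul_t_le r).trans_lt hr)
  have hC := fun a => hsplit (C δ a) (by
    refine (natDegree_sub_le _ _).trans_lt (max_lt ?_ ?_)
    · refine (natDegree_mul_le _ _).trans_lt ?_
      rwa [natDegree_C, zero_add]
    · refine (natDegree_mul_le _ _).trans_lt ?_
      rwa [natDegree_C, add_zero])
  obtain ⟨c, rfl⟩ := eq_C_of_commute hδ (fun a => (hC a).2) hr
  have hc := mem_constField_of_commute δ ht.2
  obtain ⟨P, hP⟩ : ∃ P : (constField δ)[X], aeval (x δ) P = q := by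
    by_cases hq : q = 0
    · exact ⟨0, by rw [hq, map_zero]⟩
    refine ih q.natDegree ?_ (commute_of_commute_t_of_commute_C δ ht.1 fun a => (hC a).1) rfl
    have h1 := natDegree_mul hq (x_ne_zero hδ)
    have h2 := natDegree_sub_le (q * x δ + C δ c) (C δ c)
    rw [add_sub_cancel_right, h1, hn, natDegree_C, natDegree_x] at h2
    have := natDegree_derivMinpoly_pos hδ
    omega
  refine ⟨P * X + Polynomial.C ⟨c, hc⟩, ?_⟩
  rw [map_add, map_mul, hP, aeval_X, aeval_C]
  rfl

theorem aeval_x_mem_center (P : (constField δ)[X]) :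
    aeval (x δ) P ∈ Subring.center (DiffPoly δ) := by
  rw [Subring.mem_center_iff]
  intro g
  change Commute g _
  rw [aeval_eq_sum_range]
  refine Commute.sum_right _ _ _ fun i _ => ?_
  rw [Algebra.smul_def]
  exact (Algebra.commute_algebraMap_right _ _).mul_right ((commute_x hδ g).pow_right i)

end Center

end DiffPoly

/-! ### Matrices whose derivative is a commutator. -/

section DualNumber

variable {A : Type*} [CommRing A]

/-- The ring homomorphism `a ↦ a + D(a) ε` to the dual numbers attached to a derivation. -/
def Derivation.toDualNumber (D : Derivation ℤ A A) : A →+* DualNumber A where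
  toFun a := TrivSqZeroExt.inl a + TrivSqZeroExt.inr (D a)
  map_one' := by ext <;> simp
  map_zero' := by ext <;> simp
  map_add' a b := by ext <;> simp
  map_mul' a b := by ext <;> simp [mul_comm]

/-- The coefficients of the characteristic polynomial of a matrix whose derivative is a commutator
are constants. -/
theorem Matrix.derivation_charpoly_coeff_eq_zero {n : Type*} [Fintype n] [DecidableEq n]
    (D : Derivation ℤ A A) (M Γ : Matrix n n A) (h : M.map D = Γ * M - M * Γ) (i : ℕ) :
    D (M.charpoly.coeff i) = 0 := by
  let ι : A →+* DualNumber A := TrivSqZeroExt.inlHom A A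
  let E : Matrix n n (DualNumber A) := Γ.map TrivSqZeroExt.inr
  have hinr : ∀ B C : Matrix n n A, B.map (TrivSqZeroExt.inr : A → DualNumber A) *
      C.map TrivSqZeroExt.inr = 0 := fun B C => by
    ext i j <;> simp [Matrix.mul_apply]
  have hEM : E * ι.mapMatrix M = (Γ * M).map TrivSqZeroExt.inr := by
    ext i j
    · simp [E, ι, Matrix.mul_apply, TrivSqZeroExt.fst_sum]
    · simp [E, ι, Matrix.mul_apply, TrivSqZeroExt.snd_sum]
  have hME : ι.mapMatrix M * E = (M * Γ).map TrivSqZeroExt.inr := by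
    ext i j
    · simp [E, ι, Matrix.mul_apply, TrivSqZeroExt.fst_sum]
    · simp [E, ι, Matrix.mul_apply, TrivSqZeroExt.snd_sum, mul_comm]
  -- Since ε² = 0, the inverse of 1 + Γε is 1 - Γε, and conjugating M by it gives M + (ΓM - MΓ)ε = M
  -- + D(M)ε.
  let U : (Matrix n n (DualNumber A))ˣ := ⟨1 + E, 1 - E,
    by rw [mul_sub, mul_one, add_mul, one_mul, hinr, add_zero, add_sub_cancel_right],
    by rw [mul_add, mul_one, sub_mul, one_mul, hinr, sub_zero, sub_add_cancel]⟩
  have hconj : U.val * ι.mapMatrix M * U.val⁻¹ = D.toDualNumber.mapMatrix M := by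
    rw [← Matrix.coe_units_inv]
    change (1 + E) * ι.mapMatrix M * (1 - E) = _
    rw [mul_sub, mul_one, add_mul, add_mul, one_mul, hEM, hME, hinr, add_zero, add_sub_assoc,
      RingHom.mapMatrix_apply, RingHom.mapMatrix_apply]
    ext i j
    · simp [ι, Derivation.toDualNumber]
    · have := congrFun (congrFun h i) j
      rw [Matrix.map_apply, Matrix.sub_apply] at this
      simp [ι, Derivation.toDualNumber, this]
  -- Conjugate matrices have the same characteristic polynomial; the ε-part of its coefficients is 0
  -- on one side and their derivative on the other.
  have hc := Matrix.charpoly_units_conj U (ι.mapMatrix M)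
  rw [hconj, RingHom.mapMatrix_apply, RingHom.mapMatrix_apply, Matrix.charpoly_map,
    Matrix.charpoly_map] at hc
  have := congrArg (fun P => TrivSqZeroExt.snd (P.coeff i)) hc
  simpa [ι, Derivation.toDualNumber] using this

end DualNumber

namespace DiffPoly

/-! ### The matrix representation over K[x] and its determinant. -/

section Representation

variable {K : Type*} [Field K] {δ : Derivation ℤ K K}
variable (hδ : IsAlgebraic (constField δ) (derivEnd δ))

/-- Right multiplication by f is left K[x]-linear. With coordinates as row vectors, it yields a ring
homomorphism rather than an anti-homomorphism. -/
theorem vecMul_coords (g f : DiffPoly δ) :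
    Matrix.vecMul (coords hδ g) (Matrix.of fun i : Fin _ => coords hδ (t δ ^ (i : ℕ) * f)) =
      coords hδ (g * f) := by
  conv_rhs => rw [← ofCoords_coords hδ g, ofCoords_apply, Finset.sum_mul, map_sum]
  ext1 j
  simp only [mul_assoc, coords_inclX_mul, Finset.sum_apply, Matrix.vecMul, dotProduct,
    Matrix.of_apply]

/-- The matrix of right multiplication by a skew polynomial with respect to the `K[x]`-basis
`1, t, …`. -/
noncomputable def toMatrix : DiffPoly δ →+*
    Matrix (Fin (derivMinpoly δ).natDegree) (Fin (derivMinpoly δ).natDegree) K[X] where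
  toFun f := Matrix.of fun i => coords hδ (t δ ^ (i : ℕ) * f)
  map_zero' := by ext; simp
  map_one' := by
    ext i j : 2
    rw [Matrix.of_apply, mul_one, coords_t_pow, Matrix.one_eq_pi_single]
  map_add' f g := by
    ext i j : 2
    simp [mul_add]
  map_mul' f g := by
    ext1 i j
    rw [Matrix.mul_apply_eq_vecMul, Matrix.of_apply, ← mul_assoc, ← vecMul_coords]
    rfl

theorem toMatrix_apply (f : DiffPoly δ) (i : Fin (derivMinpoly δ).natDegree) :
    toMatrix hδ f i = coords hδ (t δ ^ (i : ℕ) * f) := rfl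

theorem vecMul_toMatrix (g f : DiffPoly δ) :
    Matrix.vecMul (coords hδ g) (toMatrix hδ f) = coords hδ (g * f) := vecMul_coords hδ g f

theorem toMatrix_injective : Function.Injective (toMatrix hδ) := by
  rw [injective_iff_map_eq_zero]
  intro f hf
  have := vecMul_toMatrix hδ 1 f
  rw [hf, Matrix.vecMul_zero, one_mul, eq_comm] at this
  exact (coords hδ).map_eq_zero_iff.1 this

/-- A central element moves to the left of t^i and there scales the basis vector. -/
theorem toMatrix_aeval_x (P : (constField δ)[X]) :
    toMatrix hδ (aeval (x δ) P) = Matrix.scalar _ (P.map (constField δ).subtype) := by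
  ext1 i j
  have hc := Subring.mem_center_iff.1 (aeval_x_mem_center hδ P) (t δ ^ (i : ℕ))
  rw [toMatrix_apply, hc, ← inclX_map hδ, coords_inclX_mul, coords_t_pow, Matrix.scalar_apply,
    Matrix.diagonal_apply]
  simp [Pi.single_apply, eq_comm]

/-- The extension of `δ` to `K[x]` that annihilates `x`. -/
noncomputable def derivX (δ : Derivation ℤ K K) : Derivation ℤ K[X] K[X] :=
  PolynomialModule.equivPolynomialSelf.toLinearMap.compDer δ.mapCoeffs

theorem coeff_derivX (P : K[X]) (i : ℕ) : (derivX δ P).coeff i = δ (P.coeff i) := rfl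

theorem derivX_monomial (i : ℕ) (a : K) : derivX δ (monomial i a) = monomial i (δ a) := by
  ext j
  simp only [coeff_derivX, coeff_monomial]
  split_ifs <;> simp

theorem exists_map_eq_of_derivX_eq_zero {P : K[X]} (h : derivX δ P = 0) :
    ∃ Q : (constField δ)[X], Q.map (constField δ).subtype = P :=
  (Polynomial.mem_lifts _).1 ((Polynomial.lifts_iff_coeff_lifts _).2 fun i =>
    ⟨⟨P.coeff i, by rw [mem_constField, ← coeff_derivX, h, coeff_zero]⟩, rfl⟩)

theorem t_mul_inclX (P : K[X]) :
    t δ * inclX hδ P = inclX hδ P * t δ + inclX hδ (derivX δ P) := by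
  induction P using Polynomial.induction_on' with
  | add p q hp hq => simp only [map_add, mul_add, add_mul, hp, hq]; abel
  | monomial i a =>
    rw [derivX_monomial]
    simp only [← C_mul_X_pow_eq_monomial, map_mul, map_pow, inclX_C, inclX_X]
    rw [← mul_assoc, t_mul_C, add_mul, mul_assoc, mul_assoc, ((commute_t_x δ).pow_right i).eq]

/-- For g = ∑ vⱼ(x) tʲ, the relation t v = v t + v' gives tg - gt = ∑ vⱼ'(x) tʲ. With g = t^i f,
this is row i of the identity. -/
theorem map_derivX_toMatrix (f : DiffPoly δ) : (toMatrix hδ f).map (derivX δ) =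
    toMatrix hδ (t δ) * toMatrix hδ f - toMatrix hδ f * toMatrix hδ (t δ) := by
  rw [eq_sub_iff_add_eq, ← map_mul, ← map_mul]
  ext1 i j
  have key : (fun j => derivX δ (coords hδ (t δ ^ (i : ℕ) * f) j)) +
      coords hδ (t δ ^ (i : ℕ) * (f * t δ)) = coords hδ (t δ ^ (i : ℕ) * (t δ * f)) := by
    apply ofCoords_injective hδ
    rw [map_add, ofCoords_coords, ofCoords_coords, ← mul_assoc, ← mul_assoc, ← pow_succ, pow_succ',
      mul_assoc (t δ)]
    generalize t δ ^ (i : ℕ) * f = g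
    conv_rhs => rw [← ofCoords_coords hδ g]
    conv_lhs => rw [← ofCoords_coords hδ g]
    simp only [coords_ofCoords]
    rw [ofCoords_apply, ofCoords_apply, Finset.mul_sum, Finset.sum_mul, ← Finset.sum_add_distrib]
    refine Finset.sum_congr rfl fun j _ => ?_
    rw [← mul_assoc, t_mul_inclX, mul_assoc, add_mul, mul_assoc, ← pow_succ, ← pow_succ',
      add_comm]
  exact congrFun key j

theorem exists_map_eq_charpoly_coeff (f : DiffPoly δ) (i : ℕ) :
    ∃ P : (constField δ)[X], P.map (constField δ).subtype = (toMatrix hδ f).charpoly.coeff i :=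
  exists_map_eq_of_derivX_eq_zero
    (Matrix.derivation_charpoly_coeff_eq_zero _ _ _ (map_derivX_toMatrix hδ f) i)

/-- The determinant of the matrix of `f` lies in `F[x]` and is a multiple of `f` on both sides. -/
theorem exists_map_eq_det (f : DiffPoly δ) : ∃ P : (constField δ)[X],
    P.map (constField δ).subtype = (toMatrix hδ f).det ∧
      ∃ h : DiffPoly δ, aeval (x δ) P = f * h ∧ aeval (x δ) P = h * f := by
  choose P hP using exists_map_eq_charpoly_coeff hδ f
  -- Cayley–Hamilton for the matrix, pulled back to f itself by injectivity.
  have hCH : ∑ i ∈ Finset.range ((toMatrix hδ f).charpoly.natDegree + 1),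
      aeval (x δ) (P i) * f ^ i = 0 := by
    apply toMatrix_injective hδ
    have := Matrix.aeval_self_charpoly (toMatrix hδ f)
    rw [aeval_eq_sum_range] at this
    rw [map_sum, map_zero, ← this]
    refine Finset.sum_congr rfl fun i _ => ?_
    rw [map_mul, map_pow, toMatrix_aeval_x, hP, Algebra.smul_def]
    rfl
  rw [Finset.sum_range_succ', pow_zero, mul_one] at hCH
  let s : DiffPoly δ := (-1) ^ (Fintype.card (Fin (derivMinpoly δ).natDegree))
  have haev : aeval (x δ) ((-1 : (constField δ)[X]) ^
      (Fintype.card (Fin (derivMinpoly δ).natDegree))) = s := by simp [s]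
  have hs : ∀ g : DiffPoly δ, Commute g s := fun g => (Commute.neg_one_right g).pow_right _
  -- This is (χ(f) - χ(0)) / f for the characteristic polynomial χ. It is a polynomial in f with
  -- central coefficients, so it commutes with f and one cofactor serves both sides.
  let u := ∑ i ∈ Finset.range (toMatrix hδ f).charpoly.natDegree, aeval (x δ) (P (i + 1)) * f ^ i
  have hu : aeval (x δ) (P 0) = - (u * f) := by
    rw [eq_neg_of_add_eq_zero_right hCH, Finset.sum_mul]
    simp only [mul_assoc, pow_succ]
  have hfu : Commute f u := Commute.sum_right _ _ _ fun i _ =>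
    Commute.mul_right (Subring.mem_center_iff.1 (aeval_x_mem_center hδ _) f)
      (Commute.self_pow f i)
  refine ⟨(-1) ^ (Fintype.card (Fin (derivMinpoly δ).natDegree)) * P 0, ?_, -(s * u), ?_, ?_⟩
  · rw [Matrix.det_eq_sign_charpoly_coeff, ← hP]
    simp
  · rw [map_mul, haev, hu, mul_neg, mul_neg, ← mul_assoc f, (hs f).eq, mul_assoc s, hfu.eq]
  · rw [map_mul, haev, hu, mul_neg, neg_mul, mul_assoc]

end Representation

end DiffPoly

/-! ### The leading term of a determinant with weighted degree bounds. -/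

section LeadingTerm

theorem coe_finRotate_pow_apply {n : ℕ} (m : ℕ) (i : Fin n) :
    ((finRotate n ^ m) i : ℕ) = (m + i) % n := by
  obtain ⟨n, rfl⟩ : ∃ k, n = k + 1 := ⟨n - 1, by have := i.2; omega⟩
  induction m with
  | zero => simp [Nat.mod_eq_of_lt i.2]
  | succ m ih =>
    rw [pow_succ', Equiv.Perm.mul_apply, finRotate_apply, Fin.val_add, ih, Fin.val_one',
      ← Nat.add_mod]
    congr 1
    omega

variable {A : Type*} [CommRing A] [IsDomain A] {n : ℕ} {M : Matrix (Fin n) (Fin n) A[X]} {m : ℕ}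

/-- Sum the bounds over i: the sums of i and of σ(i) cancel, leaving n · deg ≤ n · m. Equality
requires it in every row, hence σ(i) ≡ m + i mod n, which is the m-th power of the rotation. -/
theorem natDegree_prod_perm_le (hM : ∀ i j, M i j ≠ 0 → n * (M i j).natDegree + j ≤ m + i)
    (hn : 0 < n) (σ : Equiv.Perm (Fin n)) (h0 : ∏ i, M i (σ i) ≠ 0) :
    (∏ i, M i (σ i)).natDegree ≤ m ∧
      (σ ≠ finRotate n ^ m → (∏ i, M i (σ i)).natDegree < m) := by
  have hne : ∀ i, M i (σ i) ≠ 0 := fun i => (Finset.prod_ne_zero_iff.1 h0) i (Finset.mem_univ i)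
  rw [natDegree_prod _ _ fun i _ => hne i]
  have hsum : ∑ i, (n * (M i (σ i)).natDegree + (σ i : ℕ)) =
      n * ∑ i, (M i (σ i)).natDegree + ∑ i : Fin n, (i : ℕ) := by
    rw [Finset.sum_add_distrib, Finset.mul_sum, Equiv.sum_comp σ (fun i => (i : ℕ))]
  have hsum' : ∑ i : Fin n, (m + (i : ℕ)) = n * m + ∑ i : Fin n, (i : ℕ) := by
    rw [Finset.sum_add_distrib]
    simp
  constructor
  · have := Finset.sum_le_sum fun (i : Fin n) (_ : i ∈ Finset.univ) => hM i (σ i) (hne i)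
    rw [hsum, hsum', add_le_add_iff_right] at this
    exact Nat.le_of_mul_le_mul_left this hn
  · intro hσ
    obtain ⟨k, hk⟩ : ∃ k, σ k ≠ (finRotate n ^ m) k := by
      by_contra! h
      exact hσ (Equiv.ext h)
    have hlt : n * (M k (σ k)).natDegree + (σ k : ℕ) < m + k := by
      refine lt_of_le_of_ne (hM k (σ k) (hne k)) fun h => hk (Fin.ext ?_)
      rw [coe_finRotate_pow_apply, ← h, Nat.mul_add_mod, Nat.mod_eq_of_lt (σ k).2]
    have := Finset.sum_lt_sum (fun (i : Fin n) (_ : i ∈ Finset.univ) => hM i (σ i) (hne i))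
      ⟨k, Finset.mem_univ k, hlt⟩
    rw [hsum, hsum', add_lt_add_iff_right] at this
    exact Nat.lt_of_mul_lt_mul_left this

/-- The leading term of the determinant of a polynomial matrix whose entries are bounded in a
weighted degree: only a cyclic permutation contributes. -/
theorem Matrix.det_leading_term (hM : ∀ i j, M i j ≠ 0 → n * (M i j).natDegree + j ≤ m + i)
    (hn : 0 < n) {a : A} (ha : a ≠ 0)
    (hlead : ∀ i, n * (M i ((finRotate n ^ m) i)).natDegree + ((finRotate n ^ m) i : ℕ) = m + i ∧
      (M i ((finRotate n ^ m) i)).leadingCoeff = a) :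
    M.det.natDegree ≤ m ∧ M.det.coeff m = (-1) ^ (m * (n - 1)) * a ^ n := by
  rw [← Matrix.det_transpose, Matrix.det_apply]
  simp only [Matrix.transpose_apply]
  constructor
  · refine natDegree_sum_le_of_forall_le _ _ fun σ _ => ?_
    by_cases h0 : ∏ i, M i (σ i) = 0
    · simp [h0]
    · exact (natDegree_smul_le _ _).trans (natDegree_prod_perm_le hM hn σ h0).1
  · have hne : ∀ i, M i ((finRotate n ^ m) i) ≠ 0 := fun i h => ha (by
      rw [← (hlead i).2, h, Polynomial.leadingCoeff_zero])
    have hdeg : (∏ i, M i ((finRotate n ^ m) i)).natDegree = m := by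
      have h : ∑ i, (n * (M i ((finRotate n ^ m) i)).natDegree + ((finRotate n ^ m) i : ℕ)) =
        ∑ i : Fin n, (m + (i : ℕ)) := Finset.sum_congr rfl fun i _ => (hlead i).1
      rw [Finset.sum_add_distrib, Finset.sum_add_distrib, ← Finset.mul_sum,
        Equiv.sum_comp (finRotate n ^ m) (fun i => (i : ℕ)), add_left_inj] at h
      rw [natDegree_prod _ _ fun i _ => hne i]
      refine Nat.eq_of_mul_eq_mul_left hn (h.trans ?_)
      simp
    rw [finsetSum_coeff, Finset.sum_eq_single (finRotate n ^ m)]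
    · have hc : (∏ i, M i ((finRotate n ^ m) i)).coeff m = a ^ n := by
        have h := leadingCoeff_prod Finset.univ fun i => M i ((finRotate n ^ m) i)
        rw [Polynomial.leadingCoeff, hdeg, Finset.prod_congr rfl fun i _ => (hlead i).2] at h
        simpa using h
      -- The sign of the theorem is that of the m-th power of an n-cycle.
      rw [coeff_smul, hc, map_pow, sign_finRotate, ← pow_mul, mul_comm (n - 1)]
      rcases neg_one_pow_eq_or ℤˣ (m * (n - 1)) with h | h
      · have h' : (-1 : A) ^ (m * (n - 1)) = 1 := by
          have := congrArg (fun u : ℤˣ => ((u : ℤ) : A)) h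
          simpa using this
        rw [h, h', one_smul, one_mul]
      · have h' : (-1 : A) ^ (m * (n - 1)) = -1 := by
          have := congrArg (fun u : ℤˣ => ((u : ℤ) : A)) h
          simpa using this
        rw [h, h', Units.neg_smul, one_smul, neg_one_mul]
    · intro σ _ hσ
      by_cases h0 : ∏ i, M i (σ i) = 0
      · simp [h0]
      · rw [coeff_smul, coeff_eq_zero_of_natDegree_lt
          ((natDegree_prod_perm_le hM hn σ h0).2 hσ), smul_zero]
    · simp

end LeadingTerm

namespace DiffPoly

variable {K : Type*} [Field K] {δ : Derivation ℤ K K}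

/-- Row i expands t^i f, of degree m + i with leading coefficient that of f; its top term sits in
column (m + i) mod n. -/
theorem det_toMatrix_leading (hδ : IsAlgebraic (constField δ) (derivEnd δ)) {f : DiffPoly δ}
    (hf : f ≠ 0) :
    (toMatrix hδ f).det.natDegree ≤ f.natDegree ∧ (toMatrix hδ f).det.coeff f.natDegree =
      (-1) ^ (f.natDegree * ((derivMinpoly δ).natDegree - 1)) *
        f.leadingCoeff ^ (derivMinpoly δ).natDegree := by
  have hrow : ∀ i, toMatrix hδ f i ≠ 0 := fun i h => by
    rw [toMatrix_apply, (coords hδ).map_eq_zero_iff] at h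
    exact mul_ne_zero (t_pow_ne_zero _) hf h
  have hdeg : ∀ i : Fin (derivMinpoly δ).natDegree,
      (ofCoords hδ (toMatrix hδ f i)).natDegree = f.natDegree + i := fun i => by
    rw [toMatrix_apply, ofCoords_coords, natDegree_mul (t_pow_ne_zero _) hf, natDegree_t_pow,
      add_comm]
  refine Matrix.det_leading_term (fun i j hij => ?_) (natDegree_derivMinpoly_pos hδ)
    (leadingCoeff_ne_zero hf) fun i => ?_
  · exact ((ofCoords_leading hδ (hrow i)).2 j hij).trans_eq (hdeg i)
  · obtain ⟨⟨k, -, hk, hl⟩, -⟩ := ofCoords_leading hδ (hrow i)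
    rw [hdeg] at hk
    have hki : (finRotate _ ^ f.natDegree) i = k := Fin.ext (by
      rw [coe_finRotate_pow_apply, hk, Nat.mul_add_mod, Nat.mod_eq_of_lt k.2])
    rw [hki, ← hk, ← hl, toMatrix_apply, ofCoords_coords, leadingCoeff_mul, leadingCoeff_t_pow,
      one_mul]
    exact ⟨rfl, rfl⟩

end DiffPoly

namespace DiffPoly

/-! ### Wronskians and generators of K over F. -/

section Wronskian

variable {K : Type*} [Field K] {δ : Derivation ℤ K K}

theorem act_apply_eq_sum_range {f : DiffPoly δ} {n : ℕ} (hf : f.natDegree < n) (b : K) :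
    act δ f b = ∑ i ∈ Finset.range n, (toPoly f).coeff i * (δ^[i]) b := by
  rw [act, lift_apply, eval₂_eq_sum_range' _ hf, LinearMap.sum_apply]
  refine Finset.sum_congr rfl fun i _ => ?_
  rw [← act_t_pow, map_pow, act, lift_t]
  rfl

variable (hδ : IsAlgebraic (constField δ) (derivEnd δ))
include hδ

/-- A linear functional vanishing on all these vectors is a skew polynomial of degree below n that
kills K, hence 0. -/
theorem span_iterate_eq_top : Submodule.span K (Set.range fun (b : K)
    (i : Fin (derivMinpoly δ).natDegree) => (δ^[i]) b) = ⊤ := by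
  classical
  by_contra h
  obtain ⟨φ, hφ, hle⟩ := Submodule.exists_le_ker_of_lt_top _ (lt_top_iff_ne_top.2 h)
  have hφ' : ∀ v, φ v = ∑ i, φ (Pi.single i 1) * v i := fun v => by
    conv_lhs => rw [pi_eq_sum_univ' v]
    rw [map_sum]
    refine Finset.sum_congr rfl fun i _ => ?_
    rw [map_smul, smul_eq_mul, mul_comm]
  let r : DiffPoly δ := ∑ i : Fin (derivMinpoly δ).natDegree, C δ (φ (Pi.single i 1)) * t δ ^ (i : ℕ)
  have hr : r = ofCoords hδ fun i => Polynomial.C (φ (Pi.single i 1)) := by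
    simp only [r, ofCoords_apply, inclX_C]
  have hact : act δ r = 0 := by
    ext b
    have : φ (fun i => (δ^[i]) b) = 0 := hle (Submodule.subset_span ⟨b, rfl⟩)
    rw [hφ'] at this
    simp only [r, map_sum, LinearMap.sum_apply, map_mul, Module.End.mul_apply, act_C]
    rw [LinearMap.zero_apply, ← this]
    refine Finset.sum_congr rfl fun i _ => ?_
    rw [act_t_pow]
  have hr0 : r = 0 := by
    by_cases h0 : (fun i => Polynomial.C (φ (Pi.single i 1))) = 0
    · rw [hr, h0, map_zero]
    refine eq_zero_of_act_eq_zero r hact (degree_lt_derivMinpoly hδ ?_)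
    obtain ⟨⟨k, -, hk, -⟩, -⟩ := ofCoords_leading hδ h0
    rw [hr, hk, Polynomial.natDegree_C, mul_zero, zero_add]
    exact k.2
  have h0 := ofCoords_injective hδ ((hr.symm.trans hr0).trans (map_zero _).symm)
  refine hφ (LinearMap.ext fun v => ?_)
  rw [hφ']
  refine Finset.sum_eq_zero fun i _ => ?_
  rw [Polynomial.C_eq_zero.1 (congrFun h0 i), zero_mul]

/-- There are elements of `K` with nonzero Wronskian. -/
theorem exists_isUnit_wronskian : ∃ b : Fin (derivMinpoly δ).natDegree → K,
    IsUnit (Matrix.of fun (i j : Fin (derivMinpoly δ).natDegree) => (δ^[i]) (b j)) := by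
  obtain ⟨κ, a, -, hspan, hli⟩ := exists_linearIndependent' K fun (b : K)
    (i : Fin (derivMinpoly δ).natDegree) => (δ^[i]) b
  rw [span_iterate_eq_top hδ] at hspan
  let B := Module.Basis.mk hli hspan.ge
  have := Module.Finite.finite_basis B
  have := Fintype.ofFinite κ
  let e : Fin (derivMinpoly δ).natDegree ≃ κ := Fintype.equivOfCardEq (by
    rw [← Module.finrank_eq_card_basis B]
    simp)
  refine ⟨a ∘ e, ?_⟩
  rw [← Matrix.isUnit_transpose, ← Matrix.linearIndependent_rows_iff_isUnit]
  exact hli.comp e e.injective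

/-- Solve for coefficients in K that match a and its derivatives of order below n; differentiating
the relations shows that these coefficients are constants. -/
theorem exists_eq_sum_of_isUnit_wronskian {b : Fin (derivMinpoly δ).natDegree → K}
    (hb : IsUnit (Matrix.of fun (i j : Fin (derivMinpoly δ).natDegree) => (δ^[i]) (b j)))
    (a : K) : ∃ c : Fin (derivMinpoly δ).natDegree → constField δ, a = ∑ j, (c j : K) * b j := by
  set W := Matrix.of fun (i j : Fin (derivMinpoly δ).natDegree) => (δ^[i]) (b j) with hW
  obtain ⟨c, hc⟩ := (Matrix.mulVec_surjective_iff_isUnit.2 hb)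
    fun i : Fin (derivMinpoly δ).natDegree => (δ^[i]) a
  have hi : ∀ i < (derivMinpoly δ).natDegree, (δ^[i]) a = ∑ j, c j * (δ^[i]) (b j) :=
    fun i hi => by
      rw [← congrFun hc ⟨i, hi⟩]
      simp [Matrix.mulVec, dotProduct, hW, mul_comm]
  -- As x acts by 0, every operator reduces to degree below n. The case of order exactly n is needed
  -- for the last row of the system below.
  have hf : ∀ f : DiffPoly δ, act δ f a = ∑ j, c j * act δ f (b j) := fun f => by
    obtain ⟨q, r, rfl, hr⟩ := exists_eq_mul_x_add hδ f
    simp only [map_add, map_mul, act_x, mul_zero, zero_add, act_apply_eq_sum_range hr,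
      Finset.mul_sum]
    rw [Finset.sum_comm]
    refine Finset.sum_congr rfl fun i h => ?_
    rw [hi i (Finset.mem_range.1 h), Finset.mul_sum]
    exact Finset.sum_congr rfl fun j _ => by ring
  have hc0 : (fun j => δ (c j)) = 0 := by
    apply (Matrix.mulVec_injective_iff_isUnit.2 hb)
    rw [Matrix.mulVec_zero]
    ext i
    -- Subtracting this from the derivative of the i-th relation leaves ∑ δ(cⱼ) δ^i(bⱼ) = 0.
    have h := hf (t δ ^ ((i : ℕ) + 1))
    simp only [act_t_pow, Function.iterate_succ_apply'] at h
    rw [hi i i.2, map_sum] at h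
    simp only [Derivation.leibniz, smul_eq_mul, Finset.sum_add_distrib] at h
    simpa [Matrix.mulVec, dotProduct, hW] using h
  exact ⟨fun j => ⟨c j, congrFun hc0 j⟩, by
    simpa using hi 0 (natDegree_derivMinpoly_pos hδ)⟩

end Wronskian

end DiffPoly

theorem IsReducedNormOf.reducedNorm_eq {k A : Type*} [Field k] [Ring A] [Algebra k A] {a : A}
    {c : k} (h : IsReducedNormOf a c) : reducedNorm k a = c := by
  have h' : ∃ c : k, IsReducedNormOf a c := ⟨c, h⟩
  rw [reducedNorm, dif_pos h']
  exact h'.choose_spec.unique h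

/-! ### Homomorphisms out of the ring of central quotients. -/

namespace CentralQuotients

variable {R : Type*} [Ring R]

theorem of_apply (f : R) : of f = (LocalizedModule.mk f 1 : CentralQuotients R) := rfl

theorem algebraMap_smul (z : Subring.center R) (a : CentralQuotients R) :
    algebraMap (Subring.center R) (FractionRing (Subring.center R)) z • a = z • a := by
  rw [_root_.algebraMap_smul]

theorem algebraMap_algebraMap (z : Subring.center R) :
    algebraMap (FractionRing (Subring.center R)) (CentralQuotients R)
      (algebraMap (Subring.center R) (FractionRing (Subring.center R)) z) = of (z : R) := by
  rw [Algebra.algebraMap_eq_smul_one, algebraMap_smul, ← map_one (of (R := R)), of_apply, of_apply,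
    LocalizedModule.smul'_mk]
  congr 1
  exact mul_one _

theorem of_mul (z : Subring.center R) (f : R) : of ((z : R) * f) =
    algebraMap (Subring.center R) (FractionRing (Subring.center R)) z • of f := by
  rw [map_mul, ← algebraMap_algebraMap, Algebra.smul_def]

theorem exists_smul_eq_of (a : CentralQuotients R) :
    ∃ s ∈ nonZeroDivisors (Subring.center R), ∃ f : R,
      algebraMap (Subring.center R) (FractionRing (Subring.center R)) s • a = of f := by
  induction a using LocalizedModule.induction_on with | _ f s
  refine ⟨s, s.2, f, ?_⟩
  rw [algebraMap_smul, of_apply]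
  exact (LocalizedModule.smul'_mk _ _ _).trans (LocalizedModule.mk_cancel s f)

theorem exists_algHom {B : Type*} [Ring B] [Algebra (FractionRing (Subring.center R)) B]
    (ρ : R →+* B) (hρ : ∀ z : Subring.center R, ρ z =
      algebraMap (FractionRing (Subring.center R)) B (algebraMap _ _ z)) :
    ∃ Φ : CentralQuotients R →ₐ[FractionRing (Subring.center R)] B, ∀ f, Φ (of f) = ρ f := by
  let : Algebra (Subring.center R) B := Algebra.compHom B
    (algebraMap (Subring.center R) (FractionRing (Subring.center R)))
  have htower : ∀ z : Subring.center R, algebraMap (Subring.center R) B z = ρ z := fun z =>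
    (hρ z).symm
  have hunit : ∀ s : nonZeroDivisors (Subring.center R),
      IsUnit (algebraMap (Subring.center R) B s) := fun s =>
    (IsLocalization.map_units (FractionRing (Subring.center R)) s).map
      (algebraMap (FractionRing (Subring.center R)) B)
  let g : R →ₗ[Subring.center R] B :=
    { toFun := ρ
      map_add' := map_add ρ
      map_smul' := fun z f => by
        change ρ ((z : R) * f) = z • ρ f
        rw [map_mul, Algebra.smul_def, htower] }
  have hunit' : ∀ s : nonZeroDivisors (Subring.center R),
      IsUnit (algebraMap (Subring.center R) (Module.End (Subring.center R) B) s) := fun s => by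
    have := (hunit s).map (Algebra.lmul (Subring.center R) B)
    rwa [AlgHom.commutes] at this
  let l := LocalizedModule.lift (nonZeroDivisors (Subring.center R)) g hunit'
  have hl : ∀ f, l (of f) = ρ f := fun f =>
    LinearMap.congr_fun (LocalizedModule.lift_comp _ g hunit') f
  -- Multiplying by a denominator, whose image is a unit, reduces linearity and multiplicativity of
  -- `l` to those of `ρ`.
  have hls : ∀ (s : Subring.center R) (a : CentralQuotients R) (f : R),
      algebraMap (Subring.center R) (FractionRing (Subring.center R)) s • a = of f →
      algebraMap (Subring.center R) B s * l a = ρ f := fun s a f h => by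
    rw [← Algebra.smul_def, ← map_smul, ← algebraMap_smul, h, hl]
  refine ⟨AlgHom.ofLinearMap (R := FractionRing (Subring.center R))
    { toFun := l, map_add' := map_add l, map_smul' := ?_ } ?_ ?_, hl⟩
  · intro c a
    obtain ⟨s, hs, f, hf⟩ := exists_smul_eq_of a
    obtain ⟨⟨z, u⟩, hc⟩ := IsLocalization.surj (nonZeroDivisors (Subring.center R)) c
    refine ((hunit (u * ⟨s, hs⟩)).mul_right_inj).1 ?_
    rw [hls _ _ (z * f)]
    · have hz : ρ z = c • algebraMap (Subring.center R) B u := by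
        have := congrArg (algebraMap (FractionRing (Subring.center R)) B) hc
        rw [map_mul, ← hρ, ← hρ] at this
        rw [Algebra.smul_def, htower]
        exact this.symm
      rw [map_mul, hz, ← hls s a f hf, Submonoid.coe_mul, map_mul, RingHom.id_apply,
        mul_smul_comm, smul_mul_assoc, mul_assoc]
    · rw [of_mul, ← hf, Submonoid.coe_mul, map_mul, smul_smul, smul_smul, ← hc]
      congr 1
      ring
  · change l 1 = 1
    rw [← map_one ρ, ← hl, map_one of]
  · intro a b
    obtain ⟨s, hs, f, hf⟩ := exists_smul_eq_of a
    obtain ⟨u, hu, g, hg⟩ := exists_smul_eq_of b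
    refine ((hunit (⟨s, hs⟩ * ⟨u, hu⟩)).mul_right_inj).1 ?_
    change _ * l (a * b) = _ * (l a * l b)
    rw [hls _ _ (f * g)]
    · rw [map_mul, ← hls s a f hf, ← hls u b g hg, Submonoid.coe_mul, map_mul]
      simp only [mul_assoc]
      rw [← mul_assoc (l a), ← Algebra.commutes u (l a)]
      simp only [mul_assoc]
    · rw [map_mul, ← hf, ← hg, Submonoid.coe_mul, map_mul, smul_mul_smul_comm]

end CentralQuotients

theorem RingHom.IsIntegral.exists_comp_eq {A B L : Type*} [CommRing A] [IsDomain A] [CommRing B]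
    [IsDomain B] [Field L] [IsAlgClosed L] {f : A →+* B} (hf : f.IsIntegral)
    (hfi : Function.Injective f) (ψ : A →+* L) (hψ : Function.Injective ψ) :
    ∃ σ : B →+* L, ∀ a, σ (f a) = ψ a := by
  let := f.toAlgebra
  let := ψ.toAlgebra
  have : Algebra.IsIntegral A B := ⟨hf⟩
  have : FaithfulSMul A B := (faithfulSMul_iff_algebraMap_injective A B).2 hfi
  have : FaithfulSMul A L := (faithfulSMul_iff_algebraMap_injective A L).2 hψ
  exact ⟨(IsAlgClosed.lift : B →ₐ[A] L).toRingHom, fun a =>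
    (IsAlgClosed.lift : B →ₐ[A] L).commutes a⟩

namespace DiffPoly

/-! ### Splitting the ring of central quotients. -/

section Splitting

variable {K : Type*} [Field K] {δ : Derivation ℤ K K}
variable (hδ : IsAlgebraic (constField δ) (derivEnd δ))

/-- The isomorphism of `F[x]` with the center, as a homomorphism. -/
noncomputable def toCenter : (constField δ)[X] →+* Subring.center (DiffPoly δ) :=
  (aeval (x δ)).toRingHom.codRestrict _ (aeval_x_mem_center hδ)

theorem coe_toCenter (P : (constField δ)[X]) : (toCenter hδ P : DiffPoly δ) = aeval (x δ) P := rfl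

theorem toCenter_injective : Function.Injective (toCenter hδ) := by
  rw [injective_iff_map_eq_zero]
  intro P hP
  by_contra h
  refine inclX_ne_zero hδ (P := P.map (constField δ).subtype) ?_ ?_
  · rwa [Ne, Polynomial.map_eq_zero_iff Subtype.val_injective]
  · rw [inclX_map, ← coe_toCenter hδ, hP]
    rfl

theorem toCenter_surjective : Function.Surjective (toCenter hδ) := by
  intro z
  obtain ⟨P, hP⟩ := exists_aeval_x_eq_of_commute hδ fun g => Subring.mem_center_iff.1 z.2 g
  exact ⟨P, Subtype.ext hP⟩

/-- The derivative of P^p is a multiple of p, hence 0, so P^p has constant coefficients. This is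
where the characteristic enters. -/
theorem isIntegral_mapRingHom (p : ℕ) [hp : Fact p.Prime] [CharP K p] :
    (mapRingHom (constField δ).subtype).IsIntegral := by
  intro P
  obtain ⟨Q, hQ⟩ : ∃ Q : (constField δ)[X], Q.map (constField δ).subtype = P ^ p :=
    exists_map_eq_of_derivX_eq_zero (by
      rw [Derivation.leibniz_pow, ← Nat.cast_smul_eq_nsmul K[X], CharP.cast_eq_zero, zero_smul])
  refine ⟨X ^ p - Polynomial.C Q, monic_X_pow_sub_C _ hp.out.ne_zero, ?_⟩
  simp [hQ]

include hδ in
-- The bⱼ span K over F and the t^l span R over K[x], so the products bⱼ t^l span R over F[x], whose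
-- elements act as scalars.
theorem of_mem_span {L : Type*} [Field L] [Algebra (FractionRing (Subring.center (DiffPoly δ))) L]
    {b : Fin (derivMinpoly δ).natDegree → K}
    (hb : ∀ a, ∃ c : Fin (derivMinpoly δ).natDegree → constField δ, a = ∑ j, (c j : K) * b j)
    (f : DiffPoly δ) : (1 ⊗ₜ CentralQuotients.of f :
      L ⊗[FractionRing (Subring.center (DiffPoly δ))] CentralQuotients (DiffPoly δ)) ∈
    Submodule.span L (Set.range fun jl : Fin (derivMinpoly δ).natDegree ×
        Fin (derivMinpoly δ).natDegree =>
      (1 ⊗ₜ CentralQuotients.of (C δ (b jl.1) * t δ ^ (jl.2 : ℕ)) :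
        L ⊗[FractionRing (Subring.center (DiffPoly δ))] CentralQuotients (DiffPoly δ))) := by
  set S := Submodule.span L (Set.range fun jl : Fin (derivMinpoly δ).natDegree ×
        Fin (derivMinpoly δ).natDegree =>
      (1 ⊗ₜ CentralQuotients.of (C δ (b jl.1) * t δ ^ (jl.2 : ℕ)) :
        L ⊗[FractionRing (Subring.center (DiffPoly δ))] CentralQuotients (DiffPoly δ)))
  let ofS : DiffPoly δ →+
      L ⊗[FractionRing (Subring.center (DiffPoly δ))] CentralQuotients (DiffPoly δ) :=
    (TensorProduct.mk _ L _ 1).toAddMonoidHom.comp CentralQuotients.of.toAddMonoidHom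
  have hmul : ∀ (z : Subring.center (DiffPoly δ)) (f : DiffPoly δ), ofS f ∈ S →
      ofS (z * f) ∈ S := fun z f hf => by
    change 1 ⊗ₜ CentralQuotients.of _ ∈ S
    rw [CentralQuotients.of_mul, TensorProduct.tmul_smul, ← algebraMap_smul L]
    exact S.smul_mem _ hf
  have key : ∀ (P : K[X]) (l : Fin (derivMinpoly δ).natDegree),
      ofS (inclX hδ P * t δ ^ (l : ℕ)) ∈ S := fun P l => by
    induction P using Polynomial.induction_on' with
    | add p q hp hq =>
      rw [map_add, add_mul, map_add]
      exact S.add_mem hp hq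
    | monomial i a =>
      obtain ⟨c, hc⟩ := hb a
      rw [← C_mul_X_pow_eq_monomial, hc, map_sum, Finset.sum_mul, map_sum, Finset.sum_mul, map_sum]
      refine S.sum_mem fun j _ => ?_
      have : inclX hδ (Polynomial.C (c j * b j) * X ^ i) * t δ ^ (l : ℕ) =
          (toCenter hδ (monomial i (c j)) : DiffPoly δ) * (C δ (b j) * t δ ^ (l : ℕ)) := by
        rw [coe_toCenter, ← inclX_map hδ, map_monomial, ← C_mul_X_pow_eq_monomial, ← mul_assoc,
          ← inclX_C hδ, ← map_mul, map_mul Polynomial.C, mul_right_comm]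
        rfl
      rw [this]
      exact hmul _ _ (Submodule.subset_span ⟨(j, l), rfl⟩)
  change ofS f ∈ S
  rw [← ofCoords_coords hδ f, ofCoords_apply, map_sum]
  exact S.sum_mem fun l _ => key _ l

include hδ in
theorem span_eq_top {L : Type*} [Field L]
    [Algebra (FractionRing (Subring.center (DiffPoly δ))) L]
    {b : Fin (derivMinpoly δ).natDegree → K}
    (hb : ∀ a, ∃ c : Fin (derivMinpoly δ).natDegree → constField δ, a = ∑ j, (c j : K) * b j) :
    Submodule.span L (Set.range fun jl : Fin (derivMinpoly δ).natDegree ×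
        Fin (derivMinpoly δ).natDegree =>
      (1 ⊗ₜ CentralQuotients.of (C δ (b jl.1) * t δ ^ (jl.2 : ℕ)) :
        L ⊗[FractionRing (Subring.center (DiffPoly δ))] CentralQuotients (DiffPoly δ))) = ⊤ := by
  rw [eq_top_iff]
  rintro y -
  induction y using TensorProduct.induction_on with
  | zero => exact zero_mem _
  | add y z hy hz => exact add_mem hy hz
  | tmul c a =>
    obtain ⟨s, hs, f, hf⟩ := CentralQuotients.exists_smul_eq_of a
    have hs0 : algebraMap (Subring.center (DiffPoly δ))
        (FractionRing (Subring.center (DiffPoly δ))) s ≠ 0 :=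
      IsLocalization.to_map_ne_zero_of_mem_nonZeroDivisors _ le_rfl hs
    rw [← inv_smul_eq_iff₀ hs0.symm.symm |>.2 hf.symm, TensorProduct.tmul_smul,
      TensorProduct.smul_tmul', ← mul_one (_ • c), ← smul_eq_mul (_ • c), ← TensorProduct.smul_tmul']
    exact Submodule.smul_mem _ _ (of_mem_span hδ hb f)

/-- The matrices of the skew polynomials `bⱼ tˡ` stay linearly independent after an extension of
scalars when the Wronskian of the `bⱼ` is nonzero. -/
theorem eq_zero_of_sum_smul_eq_zero {L : Type*} [Field L] (σ : K[X] →+* L)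
    {b : Fin (derivMinpoly δ).natDegree → K}
    (hb : IsUnit (Matrix.of fun (i j : Fin (derivMinpoly δ).natDegree) => (δ^[i]) (b j)))
    (c : Fin (derivMinpoly δ).natDegree × Fin (derivMinpoly δ).natDegree → L)
    (hc : ∑ jl, c jl • σ.mapMatrix (toMatrix hδ (C δ (b jl.1) * t δ ^ (jl.2 : ℕ))) = 0) :
    c = 0 := by
  have hN := natDegree_derivMinpoly_pos hδ
  let ρ := σ.mapMatrix.comp (toMatrix hδ)
  -- The commutator with `ρ (t δ)` turns each bⱼ into its derivative while keeping the coefficients.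
  have hi : ∀ i : ℕ, ∑ jl, c jl • ρ (C δ ((δ^[i]) (b jl.1)) * t δ ^ (jl.2 : ℕ)) = 0 := fun i => by
    induction i with
    | zero => exact hc
    | succ i ih =>
      have h : ∀ jl : Fin (derivMinpoly δ).natDegree × Fin (derivMinpoly δ).natDegree,
          c jl • ρ (C δ ((δ^[i + 1]) (b jl.1)) * t δ ^ (jl.2 : ℕ)) =
          ρ (t δ) * (c jl • ρ (C δ ((δ^[i]) (b jl.1)) * t δ ^ (jl.2 : ℕ))) -
            (c jl • ρ (C δ ((δ^[i]) (b jl.1)) * t δ ^ (jl.2 : ℕ))) * ρ (t δ) := fun jl => by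
        rw [mul_smul_comm, smul_mul_assoc, ← smul_sub, ← map_mul, ← map_mul, ← map_sub]
        congr 2
        rw [← mul_assoc, t_mul_C, add_mul, mul_assoc, mul_assoc, ← pow_succ, ← pow_succ',
          add_sub_cancel_left, Function.iterate_succ_apply']
      rw [Finset.sum_congr rfl fun jl _ => h jl, Finset.sum_sub_distrib, ← Finset.mul_sum,
        ← Finset.sum_mul, ih, mul_zero, zero_mul, sub_zero]
  -- Row 0 holds the coordinates of the element itself. Read in column l, the relations become a
  -- Wronskian system for the `c (j, l)`.
  have hentry : ∀ (a : K) (j l : Fin (derivMinpoly δ).natDegree),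
      ρ (C δ a * t δ ^ (j : ℕ)) ⟨0, hN⟩ l = if j = l then σ (Polynomial.C a) else 0 :=
    fun a j l => by
      change σ (toMatrix hδ _ _ l) = _
      rw [toMatrix_apply, pow_zero, one_mul, ← inclX_C hδ, coords_inclX_mul, coords_t_pow]
      by_cases h : j = l
      · simp [h]
      · simp [h, Ne.symm h]
  let W := (σ.comp Polynomial.C).mapMatrix
    (Matrix.of fun (i j : Fin (derivMinpoly δ).natDegree) => (δ^[i]) (b j))
  have hW : IsUnit W := hb.map _
  have hcol : ∀ l, (fun j => c (j, l)) = 0 := fun l => by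
    apply (Matrix.mulVec_injective_iff_isUnit.2 hW)
    rw [Matrix.mulVec_zero]
    ext i
    have h := congrFun (congrFun (hi i) ⟨0, hN⟩) l
    rw [Matrix.sum_apply, Fintype.sum_prod_type] at h
    simp only [Matrix.smul_apply, hentry, smul_ite, smul_zero, Finset.sum_ite_eq',
      Finset.mem_univ, if_true] at h
    simpa [W, Matrix.mulVec, dotProduct, mul_comm] using h
  ext ⟨j, l⟩
  exact congrFun (hcol l) j

/-- The dimension of the algebra need not be known beforehand. The map `T` from L^(n²) is onto, and
its composite with `φ` is injective between spaces of dimension n², hence bijective; so `φ` is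
bijective too. -/
theorem exists_algEquiv_matrix (p : ℕ) [Fact p.Prime] [CharP K p] :
    ∃ (σ : K[X] →+* AlgebraicClosure (FractionRing (Subring.center (DiffPoly δ))))
      (φ : AlgebraicClosure (FractionRing (Subring.center (DiffPoly δ)))
          ⊗[FractionRing (Subring.center (DiffPoly δ))] CentralQuotients (DiffPoly δ)
        ≃ₐ[AlgebraicClosure (FractionRing (Subring.center (DiffPoly δ)))]
          Matrix (Fin (derivMinpoly δ).natDegree) (Fin (derivMinpoly δ).natDegree)
            (AlgebraicClosure (FractionRing (Subring.center (DiffPoly δ))))),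
      (∀ P : (constField δ)[X], σ (P.map (constField δ).subtype) =
        algebraMap (FractionRing (Subring.center (DiffPoly δ))) _
          (algebraMap _ _ (toCenter hδ P))) ∧
      ∀ f, φ (1 ⊗ₜ CentralQuotients.of f) = σ.mapMatrix (toMatrix hδ f) := by
  set k := FractionRing (Subring.center (DiffPoly δ))
  set L := AlgebraicClosure k
  obtain ⟨σ, hσ⟩ := (isIntegral_mapRingHom (δ := δ) p).exists_comp_eq
    (Polynomial.map_injective _ Subtype.val_injective)
    ((algebraMap k L).comp ((algebraMap (Subring.center (DiffPoly δ)) k).comp (toCenter hδ)))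
    ((algebraMap k L).injective.comp
      ((IsFractionRing.injective (Subring.center (DiffPoly δ)) k).comp (toCenter_injective hδ)))
  obtain ⟨Φ, hΦ⟩ := CentralQuotients.exists_algHom (σ.mapMatrix.comp (toMatrix hδ)) fun z => by
    obtain ⟨P, rfl⟩ := toCenter_surjective hδ z
    rw [coe_toCenter, RingHom.comp_apply, toMatrix_aeval_x, Matrix.algebraMap_eq_diagonal]
    have := hσ P
    rw [coe_mapRingHom] at this
    ext i j
    simp [Matrix.diagonal_apply, apply_ite σ, this]
    rfl
  let φ : L ⊗[k] CentralQuotients (DiffPoly δ) →ₐ[L] Matrix (Fin (derivMinpoly δ).natDegree)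
      (Fin (derivMinpoly δ).natDegree) L :=
    Algebra.TensorProduct.lift (Algebra.ofId L _) Φ fun c a => Algebra.commutes _ _
  have hφ : ∀ f, φ (1 ⊗ₜ CentralQuotients.of f) = σ.mapMatrix (toMatrix hδ f) := fun f => by
    refine (Algebra.TensorProduct.lift_tmul _ _ _ _ _).trans ?_
    rw [map_one, one_mul, hΦ]
    rfl
  obtain ⟨b, hb⟩ := exists_isUnit_wronskian hδ
  let T := Fintype.linearCombination L fun jl : Fin (derivMinpoly δ).natDegree ×
        Fin (derivMinpoly δ).natDegree =>
      (1 ⊗ₜ CentralQuotients.of (C δ (b jl.1) * t δ ^ (jl.2 : ℕ)) :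
        L ⊗[k] CentralQuotients (DiffPoly δ))
  have hT : Function.Surjective T := by
    rw [← LinearMap.range_eq_top, Fintype.range_linearCombination]
    exact span_eq_top hδ (exists_eq_sum_of_isUnit_wronskian hδ hb)
  have hφT : Function.Injective (φ.toLinearMap ∘ₗ T) := by
    rw [injective_iff_map_eq_zero]
    intro c hc
    refine eq_zero_of_sum_smul_eq_zero hδ σ hb c ?_
    rw [← hc]
    change _ = φ (T c)
    simp only [T, Fintype.linearCombination_apply, map_sum, map_smul, hφ]
  have hφT' : Function.Surjective (φ.toLinearMap ∘ₗ T) :=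
    (LinearMap.injective_iff_surjective_of_finrank_eq_finrank (by
      simp [Module.finrank_matrix])).1 hφT
  rw [LinearMap.coe_comp] at hφT hφT'
  exact ⟨σ, AlgEquiv.ofBijective φ ⟨hφT.of_comp_right hT, hφT'.of_comp⟩, hσ, hφ⟩

end Splitting

end DiffPoly

/-! ### The norm as a determinant, and the theorem. -/

namespace DiffPoly

variable {K : Type*} [Field K] {δ : Derivation ℤ K K}

/-- The reduced norm of `f` is the determinant of the matrix of `f`. -/
theorem norm_eq_of_map_eq_det (p : ℕ) [Fact p.Prime] [CharP K p]
    (hδ : IsAlgebraic (constField δ) (derivEnd δ)) {f : DiffPoly δ} {P : (constField δ)[X]}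
    (hP : P.map (constField δ).subtype = (toMatrix hδ f).det) :
    norm f = algebraMap _ _ (toCenter hδ P) := by
  obtain ⟨σ, φ, hσ, hφ⟩ := exists_algEquiv_matrix hδ p
  exact IsReducedNormOf.reducedNorm_eq
    ⟨_, φ, by rw [hφ, ← RingHom.map_det, ← hP, hσ]⟩

end DiffPoly

theorem mainTheorem10 {K : Type*} [Field K] (p : ℕ) [Fact p.Prime] [CharP K p]
    (δ : Derivation ℤ K K) (hδ : IsAlgebraic (constField δ) (derivEnd δ))
    (e : ℕ) (he : (derivMinpoly δ).natDegree = p ^ e) :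
    (∀ f : DiffPoly δ, ∃ P : Polynomial (constField δ),
      algebraMap (FractionRing (Subring.center (DiffPoly δ))) (CentralQuotients (DiffPoly δ))
          (DiffPoly.norm f)
        = CentralQuotients.of (Polynomial.aeval (DiffPoly.x δ) P) ∧
      ∃ h : DiffPoly δ, Polynomial.aeval (DiffPoly.x δ) P = f * h ∧
        Polynomial.aeval (DiffPoly.x δ) P = h * f) ∧
    (∀ f : DiffPoly δ, f ≠ 0 → ∃ (b : constField δ) (Q : Polynomial (constField δ)),
      (b : K) = (-1) ^ (f.natDegree * (p ^ e - 1)) * f.leadingCoeff ^ (p ^ e) ∧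
      Q.degree < (f.natDegree : WithBot ℕ) ∧
      algebraMap (FractionRing (Subring.center (DiffPoly δ))) (CentralQuotients (DiffPoly δ))
          (DiffPoly.norm f)
        = CentralQuotients.of (Polynomial.aeval (DiffPoly.x δ)
            (Polynomial.C b * Polynomial.X ^ f.natDegree + Q))) := by
  constructor
  · intro f
    obtain ⟨P, hP, h⟩ := DiffPoly.exists_map_eq_det hδ f
    refine ⟨P, ?_, h⟩
    rw [DiffPoly.norm_eq_of_map_eq_det p hδ hP, CentralQuotients.algebraMap_algebraMap]
    rfl
  · intro f hf
    obtain ⟨P, hP, -⟩ := DiffPoly.exists_map_eq_det hδ f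
    obtain ⟨hdeg, hcoeff⟩ := DiffPoly.det_toMatrix_leading hδ hf
    rw [← hP, natDegree_map] at hdeg
    rw [← hP, coeff_map, he] at hcoeff
    -- The constant includes the sign; being a coefficient of P it lies in F, and with it the power
    -- of the leading coefficient.
    refine ⟨P.coeff f.natDegree, P - Polynomial.C (P.coeff f.natDegree) * X ^ f.natDegree, hcoeff,
      ?_, ?_⟩
    · rw [degree_lt_iff_coeff_zero]
      intro i hi
      rw [coeff_sub, coeff_C_mul_X_pow]
      split_ifs with h
      · rw [h, sub_self]
      · rw [sub_zero]
        exact coeff_eq_zero_of_natDegree_lt (by omega)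
    · rw [add_sub_cancel, DiffPoly.norm_eq_of_map_eq_det p hδ hP,
        CentralQuotients.algebraMap_algebraMap]
      rfl
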